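/- **Setting.** A cost probabilistic automaton consists of a finite set $S$ of states with a start state, a set $\Sigma$ of actions partitioned into internal actions $\mathtt H$ and external actions $\mathtt E$, a finite transition relation $D \subseteq S\times\Sigma\times\mathrm{Disc}(S)$ (where $\mathrm{Disc}(S)$ is the set of probability distributions on $S$), and a cost function $c\colon D\to\mathbb R_{\ge 0}$. For $tr=(v,b,\rho)\in D$ we write $\rho_{tr}=\rho$, and $D(b)$ is the set of transitions with label $b$. A finite execution fragment is a sequence $\alpha=s_0a_1s_1\dots a_ns_n$ such that for each $i\ge 1$ there is $(s_{i-1},a_i,\rho_i)\in D$ with $\rho_i(s_i)>0$; $\mathrm{last}(\alpha)=s_n$, and $\mathrm{trace}(\alpha)$ is the subsequence of external actions among $a_1,\dots,a_n$; $\mathrm{trace}(a)=a$ for $a\in\mathtt E$, and $\mathrm{trace}(a)$ is empty for $a\in\mathtt H$. A scheduler $\sigma$ maps each finite execution fragment $\alpha$ to a sub-probability distribution on the transitions leaving $\mathrm{last}(\alpha)$; $\sigma(\alpha)(\bot)$ denotes the missing mass. It is determinate if $\sigma(\alpha)=\sigma(\alpha')$ whenever $\mathrm{trace}(\alpha)=\mathrm{trace}(\alpha')$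 and $\mathrm{last}(\alpha)=\mathrm{last}(\alpha')$. For a state $s$ let $P(C_{s})=1$, $P(C_{r})=0$ for the one-state fragments $r\ne s$, and $P(C_{\alpha b r})=P(C_\alpha)\,m_\alpha(b,r)$ with $m_\alpha(b,r)=\sum_{tr\in D(b)}\sigma(\alpha)(tr)\,\rho_{tr}(r)$; and let $P_{\sigma,s}(\alpha)=P(C_\alpha)\,\sigma(\alpha)(\bot)$. The scheduler $\sigma$ induces the weak combined transition $s\Rightarrow^a\nu$, where $\nu\in\mathrm{Disc}(S)$, if $\sum_\alpha P_{\sigma,s}(\alpha)=1$, $P_{\sigma,s}(\alpha)>0$ implies $\mathrm{trace}(\alpha)=\mathrm{trace}(a)$, and $\sum_{\mathrm{last}(\alpha)=r}P_{\sigma,s}(\alpha)=\nu(r)$ for every $r\in S$. Its cost is $c_\sigma(s\Rightarrow^a\nu)=\sum_\alpha c_\sigma(\alpha)\,P_{\sigma,s}(\alpha)\in[0,\infty]$, where $c_\sigma$ is $0$ on one-state fragments and $c_\sigma(\alpha b r)=c_\sigma(\alpha)+\sum_{tr\in D(b)}c(tr)\,\sigma(\alpha)(tr)\,\rho_{tr}(r)/m_\alpha(b,r)$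 (the last sum being $0$ if $m_\alpha(b,r)=0$). For $R\subseteq S\times S$ and $\mu,\nu\in\mathrm{Disc}(S)$, $\mu\,\mathcal L(R)\,\nu$ means that there is $w\colon S\times S\to[0,1]$ with $w(x,y)>0\Rightarrow x\,R\,y$, $\sum_y w(x,y)=\mu(x)$ and $\sum_x w(x,y)=\nu(y)$. **The linear program.** Let $t\in S$, $a\in\Sigma$, $\mu\in\mathrm{Disc}(S)$ and $R\subseteq S\times S$. For $a\in\mathtt E$ the network $(V,E)$ has as vertices a source $\vartriangle$, a sink $\blacktriangledown$, vertices $v$, $v_a$, $v_R$ for $v\in S$, and vertices $v^{tr}$, $v^{tr}_a$ for each $tr=(v,b,\rho)\in D$ with $b\in\mathtt H\cup\{a\}$. Its arcs are $(\vartriangle,t)$; $(v_a,u_R)$ and $(u_R,\blacktriangledown)$ for $u,v\in S$ with $u\,R\,v$; $(v,v^{tr})$, $(v^{tr},v')$, $(v_a,v_a^{tr})$, $(v_a^{tr},v'_a)$ for $tr=(v,b,\rho)\in D$ with $b\in\mathtt H$ and $\rho(v')>0$; and $(v,v_a^{tr})$, $(v_a^{tr},v'_a)$ for $tr=(v,a,\rho)\in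 D$ and $\rho(v')>0$. The min-cost LP has one real variable $f_{x,y}$ for each arc (with $f_{x,y}=0$ if $(x,y)\notin E$); it minimises $\sum_{(x,y)\in E}c_f(x,y)f_{x,y}$, where $c_f(v,v^{tr})=c_f(v_a,v^{tr}_a)=c(tr)$ for internal $tr$, $c_f(v,v^{tr}_a)=c(tr)$ for $tr$ with label $a$, and $c_f=0$ on all other arcs, subject to: - $f_{x,y}\ge 0$ for $(x,y)\in E$; $f_{\vartriangle,t}=1$; $f_{u_R,\blacktriangledown}=\mu(u)$ for all $u\in S$; - $\sum_{(y,x)\in E}f_{y,x}=\sum_{(x,y)\in E}f_{x,y}$ for every $x\in V\setminus\{\vartriangle,\blacktriangledown\}$; - $f_{v^{tr},v'}=\rho(v')f_{v,v^{tr}}$ and $f_{v_a^{tr},v'_a}=\rho(v')f_{v_a,v_a^{tr}}$ for $tr=(v,b,\rho)\in D$ with $b\in\mathtt H$ and $\rho(v')>0$; - $f_{v_a^{tr},v'_a}=\rho(v')f_{v,v_a^{tr}}$ for $tr=(v,a,\rho)\in D$ and $\rho(v')>0$. For $a\in\mathtt H$ the vertices $v_a$, $v_a^{tr}$, their arcs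 and the constraints on them are dropped, and the arcs $(v_a,u_R)$ are replaced by $(v,u_R)$ for $u\,R\,v$. If $f^o$ is an optimal solution, $\mathfrak C=\sum_{(x,y)\in E}c_f(x,y)f^o_{x,y}$ denotes its value. **Theorem.** For every cost probabilistic automaton as above, $R\subseteq S\times S$, $a\in\Sigma$, $\mu\in\mathrm{Disc}(S)$ and $t\in S$: 1. If a scheduler $\sigma$ induces $t\Rightarrow^a\mu_t$ with $\mu\,\mathcal L(R)\,\mu_t$, then the min-cost LP has an optimal solution, and its value satisfies $\mathfrak C\le c_\sigma(t\Rightarrow^a\mu_t)$. 2. If $f^o$ is an optimal solution of the min-cost LP, with value $\mathfrak C$, then there is a determinate scheduler $\sigma$ that induces a weak combined transition $t\Rightarrow^a\mu_t$ with $\mu\,\mathcal L(R)\,\mu_t$ and $c_\sigma(t\Rightarrow^a\mu_t)=\mathfrak C$. -/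

import Mathlib

open scoped ENNReal NNReal

universe u v

namespace CostPA

noncomputable section

/-- A transition `s --a--> ρ`. -/
structure Transition (S : Type u) (Act : Type v) where
  source : S
  action : Act
  target : PMF S

/-- A probabilistic automaton with state space `S`, actions `Act`, and a finite transition
relation. The internal actions are those in `hidden`; all the others are external. -/
structure PA (S : Type u) (Act : Type v) where
  start : S
  hidden : Set Act
  trans : Finset (Transition S Act)

/-- The transitions of `A`, as a (finite) type. -/
abbrev PA.Tr {S : Type u} {Act : Type v} (A : PA S Act) : Type (max u v) :=
  {tr : Transition S Act // tr ∈ A.trans}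

/-- A cost probabilistic automaton: each transition carries a non-negative real cost. -/
structure CPA (S : Type u) (Act : Type v) extends PA S Act where
  cost : toPA.Tr → ℝ≥0

variable {S : Type u} {Act : Type v}

/-- `Frag A s` is the type of the finite execution fragments of `A` whose last state is `s`. -/
inductive Frag (A : PA S Act) : S → Type (max u v)
  | single (s : S) : Frag A s
  | snoc {s : S} (α : Frag A s) (b : Act) (r : S)
      (h : ∃ tr ∈ A.trans, tr.source = s ∧ tr.action = b ∧ 0 < tr.target r) : Frag A r

open Classical in
/-- The trace of a single action. -/
def actTrace (A : PA S Act) (b : Act) : List Act :=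
  if b ∈ A.hidden then [] else [b]

/-- The trace of a finite execution fragment: its sequence of external actions. -/
def Frag.trace {A : PA S Act} : {s : S} → Frag A s → List Act
  | _, .single _ => []
  | _, .snoc α b _ _ => α.trace ++ actTrace A b

/-- A scheduler assigns to each finite execution fragment a subprobability distribution over the
transitions that leave its last state. The missing mass, written as the mass of `none`, is the
probability of stopping. -/
structure Scheduler (A : PA S Act) where
  choice : {s : S} → Frag A s → PMF (Option A.Tr)
  enabled : ∀ {s : S} (α : Frag A s) (tr : A.Tr), 0 < choice α (some tr) → tr.1.source = s

/-- A scheduler is determinate if its choice depends only on the trace and on the last state. -/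
def Scheduler.Determinate {A : PA S Act} (σ : Scheduler A) : Prop :=
  ∀ (s : S) (α α' : Frag A s), α.trace = α'.trace → σ.choice α = σ.choice α'

namespace Scheduler

variable {A : PA S Act}

open Classical in
/-- The sum of `σ(α)(tr) * ρ_tr(r)` over all transitions `tr` with label `b`. -/
def step (σ : Scheduler A) {s : S} (α : Frag A s) (b : Act) (r : S) : ℝ≥0∞ :=
  ∑ tr : A.Tr with tr.1.action = b, σ.choice α (some tr) * tr.1.target r

open Classical in
/-- The probability of the cone of a finite execution fragment, starting from the state `s₀`. -/
def cone (σ : Scheduler A) (s₀ : S) : {s : S} → Frag A s → ℝ≥0∞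
  | _, .single s => if s = s₀ then 1 else 0
  | _, .snoc α b r _ => σ.cone s₀ α * σ.step α b r

/-- The probability that the execution is exactly the finite execution fragment `α`. -/
def prob (σ : Scheduler A) (s₀ : S) {s : S} (α : Frag A s) : ℝ≥0∞ :=
  σ.cone s₀ α * σ.choice α none

/-- `σ` induces the weak combined transition from `s₀` to `μ` labelled by `a`. -/
structure Induces (σ : Scheduler A) (s₀ : S) (a : Act) (μ : PMF S) : Prop where
  finite : ∑' α : (s : S) × Frag A s, σ.prob s₀ α.2 = 1
  trace : ∀ (s : S) (α : Frag A s), 0 < σ.prob s₀ α → α.trace = actTrace A a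
  target : ∀ s : S, ∑' α : Frag A s, σ.prob s₀ α = μ s

open Classical in
/-- The conditional probability that `tr` was the transition taken, given that the fragment `α`
was extended by the action `b` and the state `r`. -/
def normalized (σ : Scheduler A) {s : S} (α : Frag A s) (r : S) (b : Act) (tr : A.Tr) : ℝ≥0∞ :=
  if 0 < σ.step α b r then σ.choice α (some tr) * tr.1.target r / σ.step α b r else 0

end Scheduler

variable {A : CPA S Act}

open Classical in
/-- The cost of a finite execution fragment under a scheduler. -/
def fragCost (σ : Scheduler A.toPA) : {s : S} → Frag A.toPA s → ℝ≥0∞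
  | _, .single _ => 0
  | _, .snoc α b r _ =>
      fragCost σ α +
        ∑ tr : A.Tr with tr.1.action = b, (A.cost tr : ℝ≥0∞) * σ.normalized α r b tr

/-- The cost of the weak combined transition that `σ` induces from `s₀`: the expected cost of the
fragment after which the execution stops. It may be infinite. -/
def weakCost (σ : Scheduler A.toPA) (s₀ : S) : ℝ≥0∞ :=
  ∑' α : (s : S) × Frag A.toPA s, fragCost σ α.2 * σ.prob s₀ α.2

/-- The lifting of a relation on states to distributions over states. -/
def Lift [Fintype S] (R : S → S → Prop) (μ ν : PMF S) : Prop :=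
  ∃ w : S → S → ℝ≥0∞,
    (∀ x y, w x y ≤ 1) ∧
    (∀ x y, 0 < w x y → R x y) ∧
    (∀ x, ∑ y, w x y = μ x) ∧
    (∀ y, ∑ x, w x y = ν y)

/-- Names for the vertices of the network: source, sink, `v`, `v^tr`, `v_a`, `v^tr_a`, `v_R`. -/
inductive Vertex (A : PA S Act) : Type (max u v)
  | source : Vertex A
  | sink : Vertex A
  | state (s : S) : Vertex A
  | tr (tr : A.Tr) : Vertex A
  | stateA (s : S) : Vertex A
  | trA (tr : A.Tr) : Vertex A
  | rel (s : S) : Vertex A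

/-- The vertex names correspond to a disjoint union. -/
def Vertex.equivSum (A : PA S Act) : Vertex A ≃ (Bool ⊕ S ⊕ A.Tr ⊕ S ⊕ A.Tr ⊕ S) where
  toFun
    | .source => .inl true
    | .sink => .inl false
    | .state s => .inr (.inl s)
    | .tr t => .inr (.inr (.inl t))
    | .stateA s => .inr (.inr (.inr (.inl s)))
    | .trA t => .inr (.inr (.inr (.inr (.inl t))))
    | .rel s => .inr (.inr (.inr (.inr (.inr s))))
  invFun
    | .inl true => .source
    | .inl false => .sink
    | .inr (.inl s) => .state s
    | .inr (.inr (.inl t)) => .tr t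
    | .inr (.inr (.inr (.inl s))) => .stateA s
    | .inr (.inr (.inr (.inr (.inl t)))) => .trA t
    | .inr (.inr (.inr (.inr (.inr s)))) => .rel s
  left_inv x := by cases x <;> rfl
  right_inv x := by rcases x with (_ | _) | _ | _ | _ | _ | _ <;> rfl

instance [Fintype S] (A : PA S Act) : Fintype (Vertex A) :=
  Fintype.ofEquiv _ (Vertex.equivSum A).symm

/-- The vertices that occur in the network for the label `a`. If `a` is internal, there are no
vertices `v_a` and `v^tr_a`. -/
def IsVertex (A : PA S Act) (a : Act) : Vertex A → Prop
  | .source => True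
  | .sink => True
  | .state _ => True
  | .tr t => t.1.action = a ∨ t.1.action ∈ A.hidden
  | .stateA _ => a ∉ A.hidden
  | .trA t => a ∉ A.hidden ∧ (t.1.action = a ∨ t.1.action ∈ A.hidden)
  | .rel _ => True

/-- The arcs of the network for the start state `t`, the label `a` and the relation `R`. An arc
into `u_R` from the copy of `v` at which the execution may stop is present if `R u v`. -/
inductive Arc (A : PA S Act) (t : S) (a : Act) (R : S → S → Prop) : Vertex A → Vertex A → Prop
  | source : Arc A t a R .source (.state t)
  | relHidden (ha : a ∈ A.hidden) {u v : S} (h : R u v) : Arc A t a R (.state v) (.rel u)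
  | relExternal (ha : a ∉ A.hidden) {u v : S} (h : R u v) : Arc A t a R (.stateA v) (.rel u)
  | sink {u v : S} (h : R u v) : Arc A t a R (.rel u) .sink
  | hiddenIn (tr : A.Tr) (h : tr.1.action ∈ A.hidden) :
      Arc A t a R (.state tr.1.source) (.tr tr)
  | hiddenOut (tr : A.Tr) (h : tr.1.action ∈ A.hidden) {r : S} (hr : 0 < tr.1.target r) :
      Arc A t a R (.tr tr) (.state r)
  | hiddenInA (ha : a ∉ A.hidden) (tr : A.Tr) (h : tr.1.action ∈ A.hidden) :
      Arc A t a R (.stateA tr.1.source) (.trA tr)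
  | hiddenOutA (ha : a ∉ A.hidden) (tr : A.Tr) (h : tr.1.action ∈ A.hidden) {r : S}
      (hr : 0 < tr.1.target r) : Arc A t a R (.trA tr) (.stateA r)
  | externalIn (ha : a ∉ A.hidden) (tr : A.Tr) (h : tr.1.action = a) :
      Arc A t a R (.state tr.1.source) (.trA tr)
  | externalOut (ha : a ∉ A.hidden) (tr : A.Tr) (h : tr.1.action = a) {r : S}
      (hr : 0 < tr.1.target r) : Arc A t a R (.trA tr) (.stateA r)

open Classical in
/-- The cost coefficients of the objective function. -/
def arcCost (A : CPA S Act) (a : Act) : Vertex A.toPA → Vertex A.toPA → ℝ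
  | .state w, .tr t => if t.1.action ∈ A.hidden ∧ w = t.1.source then A.cost t else 0
  | .stateA w, .trA t => if t.1.action ∈ A.hidden ∧ w = t.1.source then A.cost t else 0
  | .state w, .trA t => if t.1.action = a ∧ w = t.1.source then A.cost t else 0
  | _, _ => 0

open Classical in
/-- The objective function of the linear program. -/
def objective [Fintype S] (A : CPA S Act) (t : S) (a : Act) (R : S → S → Prop)
    (f : Vertex A.toPA → Vertex A.toPA → ℝ) : ℝ :=
  ∑ e : Vertex A.toPA × Vertex A.toPA with Arc A.toPA t a R e.1 e.2,
    arcCost A a e.1 e.2 * f e.1 e.2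

open Classical in
/-- The feasible solutions of the linear program. The variables are indexed by the arcs; a solution
is extended by zero to all pairs of vertices. -/
structure Feasible [Fintype S] (A : PA S Act) (t : S) (a : Act) (μ : PMF S) (R : S → S → Prop)
    (f : Vertex A → Vertex A → ℝ) : Prop where
  support : ∀ x y, ¬ Arc A t a R x y → f x y = 0
  nonneg : ∀ x y, Arc A t a R x y → 0 ≤ f x y
  source : f .source (.state t) = 1
  sink : ∀ u : S, f (.rel u) .sink = (μ u).toReal
  conservation : ∀ x, IsVertex A a x → x ≠ .source → x ≠ .sink →
    (∑ y with Arc A t a R y x, f y x) - ∑ y with Arc A t a R x y, f x y = 0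
  balanceHidden : ∀ tr : A.Tr, tr.1.action ∈ A.hidden → ∀ r : S, 0 < tr.1.target r →
    f (.tr tr) (.state r) - (tr.1.target r).toReal * f (.state tr.1.source) (.tr tr) = 0
  balanceHiddenA : a ∉ A.hidden →
    ∀ tr : A.Tr, tr.1.action ∈ A.hidden → ∀ r : S, 0 < tr.1.target r →
      f (.trA tr) (.stateA r) - (tr.1.target r).toReal * f (.stateA tr.1.source) (.trA tr) = 0
  balanceExternal : a ∉ A.hidden →
    ∀ tr : A.Tr, tr.1.action = a → ∀ r : S, 0 < tr.1.target r →
      f (.trA tr) (.stateA r) - (tr.1.target r).toReal * f (.state tr.1.source) (.trA tr) = 0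

/-- The optimal solutions of the min-cost linear program. -/
def Optimal [Fintype S] (A : CPA S Act) (t : S) (a : Act) (μ : PMF S) (R : S → S → Prop)
    (f : Vertex A.toPA → Vertex A.toPA → ℝ) : Prop :=
  Feasible A.toPA t a μ R f ∧
    ∀ g, Feasible A.toPA t a μ R g → objective A t a R f ≤ objective A t a R g

end

end CostPA

/-! The network consists of two copies of the state space, for the empty trace and for the trace
`a`. A feasible solution amounts to two functions: `x p tr`, to be thought of as the expected number
of times that `tr` is taken in the copy `p`, and `y u w`, the mass that stops at `w` and is matched
with `u`, which is a weight function for the lifting. The arguments are carried out for this reduced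
program `IsFlow` and transferred by `arcFlow`.

From schedulers to flows: even at finite cost the expected number of uses of a transition may be
infinite, since transitions may be free, so a flow cannot be read off directly. Counting only the
first `n` steps gives finite flows. Their defect in the balance equations comes from the mass still
running and the mass yet to stop, both of which tend to zero, while their cost stays below
`weakCost` (`sum_stepCost_le_weakCost`). The pairs of constraint values and cost attained by
nonnegative vectors form a finitely generated cone, which is closed
(`ConicLP.isClosed_image_nonneg`). Hence an exact flow of no larger cost exists. The same closedness
shows that the optimum is attained.

From flows to schedulers: in each copy of a state, choose in proportion to the outgoing flow. By
balance and induction, the expected number of visits is at most the flow through the node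
(`IsFlow.sum_occupation_le`). So the expected length is finite and the execution stops almost
surely. The stopping distribution is bounded by the column sums of `y` and has the same total mass,
so it equals them. The flow may contain circulations that the scheduler never enters, so this only
bounds the cost from above by the value of the flow. For an optimal flow, the reverse bound is the
first half applied to this very scheduler. -/

open Filter Topology

/-! ### Closedness of finitely generated cones and attainment in linear programs -/

namespace ConicLP

variable {ι E : Type*} [Fintype ι] [AddCommGroup E] [Module ℝ E]

/-- The vectors that vanish outside `s`. -/
def supportedOn (s : Set ι) : Submodule ℝ (ι → ℝ) where
  carrier := {z | ∀ i, i ∉ s → z i = 0}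
  add_mem' := by
    intro x y hx hy i hi
    simp [hx i hi, hy i hi]
  zero_mem' := by simp
  smul_mem' := by
    intro c x hx i hi
    simp [hx i hi]

/-- Conic Carathéodory: every value of `L` on the nonnegative orthant is attained at a nonnegative
vector on whose support `L` is injective. -/
theorem exists_nonneg_injOn_support (L : (ι → ℝ) →ₗ[ℝ] E) (z : ι → ℝ) (hz : 0 ≤ z) :
    ∃ (s : Set ι) (z' : ι → ℝ), 0 ≤ z' ∧ L z' = L z ∧ z' ∈ supportedOn s ∧
      ∀ d ∈ supportedOn s, L d = 0 → d = 0 := by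
  classical
  induction hn : (Finset.univ.filter fun i => z i ≠ 0).card using Nat.strong_induction_on
    generalizing z with
  | _ n ih =>
  by_cases hinj : ∀ d ∈ supportedOn {i | z i ≠ 0}, L d = 0 → d = 0
  · exact ⟨{i | z i ≠ 0}, z, hz, rfl, fun i hi => by simpa using hi, hinj⟩
  push Not at hinj
  obtain ⟨d, hd, hLd, hd0⟩ := hinj
  obtain ⟨d, hd, hLd, hpos⟩ : ∃ d ∈ supportedOn {i | z i ≠ 0}, L d = 0 ∧ ∃ i, 0 < d i := by
    obtain ⟨i, hi⟩ := Function.ne_iff.1 hd0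
    rcases lt_or_gt_of_ne hi with h | h
    · exact ⟨-d, neg_mem hd, by simp [hLd], i, by simpa using h⟩
    · exact ⟨d, hd, hLd, i, h⟩
  -- Ratio test: `z i₀ / d i₀` is the largest multiple of `d` that can be subtracted from `z`
  -- without leaving the orthant. The coordinate `i₀` then vanishes, and the support shrinks
  -- strictly.
  obtain ⟨i₀, hi₀, hmin⟩ := Finset.exists_min_image (Finset.univ.filter fun i => 0 < d i)
    (fun i => z i / d i) (by simpa [Finset.filter_nonempty_iff] using hpos)
  simp only [Finset.mem_filter, Finset.mem_univ, true_and] at hi₀ hmin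
  have hθ : 0 ≤ z i₀ / d i₀ := div_nonneg (hz i₀) hi₀.le
  set θ := z i₀ / d i₀ with hθdef
  have hval : ∀ i, (z - θ • d) i = z i - θ * d i := fun i => by simp
  have hnonneg : 0 ≤ z - θ • d := by
    intro i
    rw [hval, Pi.zero_apply, sub_nonneg]
    by_cases hi : 0 < d i
    · exact (le_div_iff₀ hi).1 (hmin i hi)
    · exact (mul_nonpos_of_nonneg_of_nonpos hθ (not_lt.1 hi)).trans (hz i)
  have hsupp : ∀ i, z i = 0 → (z - θ • d) i = 0 := fun i hi => by
    rw [hval, hi, hd i (by simpa using hi)]; simp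
  have hi₀z : z i₀ ≠ 0 := fun h => hi₀.ne' (hd i₀ (by simpa using h))
  have hlt : (Finset.univ.filter fun i => (z - θ • d) i ≠ 0).card < n := by
    rw [← hn]
    refine Finset.card_lt_card ⟨?_, ?_⟩
    · intro i hi
      simp only [Finset.mem_filter, Finset.mem_univ, true_and] at hi ⊢
      exact fun h => hi (hsupp i h)
    · intro h
      have := h (show i₀ ∈ Finset.univ.filter fun i => z i ≠ 0 by simpa using hi₀z)
      simp only [Finset.mem_filter, Finset.mem_univ, true_and] at this
      apply this
      rw [hval, hθdef, div_mul_cancel₀ _ hi₀.ne', sub_self]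
  obtain ⟨s, z', h1, h2, h3, h4⟩ := ih _ hlt _ hnonneg rfl
  exact ⟨s, z', h1, by rw [h2]; simp [hLd], h3, h4⟩

variable [TopologicalSpace E] [IsTopologicalAddGroup E] [ContinuousSMul ℝ E] [T2Space E]

/-- A finitely generated convex cone is closed. -/
theorem isClosed_image_nonneg (L : (ι → ℝ) →ₗ[ℝ] E) : IsClosed (Set.image L {z | 0 ≤ z}) := by
  classical
  -- By Carathéodory, the cone is a union over the finitely many supports on which `L` is injective.
  -- On each of them `L` is a closed embedding and sends the closed orthant to a closed set.
  have key : Set.image L {z | 0 ≤ z} = ⋃ s ∈ {s : Set ι | ∀ d ∈ supportedOn s, L d = 0 → d = 0},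
      Set.image (L ∘ₗ (supportedOn s).subtype) {z | 0 ≤ (z : ι → ℝ)} := by
    ext e
    simp only [Set.mem_image, Set.mem_iUnion, Set.mem_ofPred_eq, exists_prop]
    constructor
    · rintro ⟨z, hz, rfl⟩
      obtain ⟨s, z', h1, h2, h3, h4⟩ := exists_nonneg_injOn_support L z hz
      exact ⟨s, h4, ⟨z', h3⟩, h1, h2⟩
    · rintro ⟨s, -, z, hz, rfl⟩
      exact ⟨z, hz, rfl⟩
  rw [key]
  refine Set.Finite.isClosed_biUnion (Set.toFinite _) fun s hs => ?_
  have hker : LinearMap.ker (L ∘ₗ (supportedOn s).subtype) = ⊥ := by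
    refine LinearMap.ker_eq_bot'.2 fun d hd => ?_
    exact Subtype.ext (hs d d.2 hd)
  refine (LinearMap.isClosedEmbedding_of_injective hker).isClosedMap _ ?_
  exact isClosed_le continuous_const continuous_subtype_val

/-- Approximate nonnegative solutions of a linear system with bounded cost yield an exact one. -/
theorem exists_nonneg_of_tendsto (L : (ι → ℝ) →ₗ[ℝ] E) (c : (ι → ℝ) →ₗ[ℝ] ℝ)
    (hc : ∀ z, 0 ≤ z → 0 ≤ c z) {b : E} {K : ℝ} {z : ℕ → ι → ℝ} (hz : ∀ n, 0 ≤ z n)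
    (hL : Tendsto (fun n => L (z n)) atTop (𝓝 b)) (hK : ∀ n, c (z n) ≤ K) :
    ∃ z', 0 ≤ z' ∧ L z' = b ∧ c z' ≤ K := by
  -- The vectors `z n` may be unbounded, but their costs lie in a compact interval. Along a
  -- subsequence the pairs (value, cost) converge, and the limit stays in the closed cone generated
  -- by `L.prod c`.
  obtain ⟨C, hC, φ, hφ, hlim⟩ := (isCompact_Icc (a := (0 : ℝ)) (b := K)).tendsto_subseq
    (x := fun n => c (z n)) fun n => ⟨hc _ (hz n), hK n⟩
  have hpair : Tendsto (fun n => (L.prod c) (z (φ n))) atTop (𝓝 (b, C)) :=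
    (hL.comp hφ.tendsto_atTop).prodMk_nhds hlim
  obtain ⟨z', hz', h⟩ := (isClosed_image_nonneg (L.prod c)).mem_of_tendsto hpair
    (Eventually.of_forall fun n => ⟨z (φ n), hz _, rfl⟩)
  replace h := Prod.ext_iff.1 h
  exact ⟨z', hz', h.1, h.2.le.trans hC.2⟩

/-- A feasible linear program with nonnegative cost has an optimal solution. -/
theorem exists_optimal (L : (ι → ℝ) →ₗ[ℝ] E) (c : (ι → ℝ) →ₗ[ℝ] ℝ)
    (hc : ∀ z, 0 ≤ z → 0 ≤ c z) {b : E} (h : ∃ z, 0 ≤ z ∧ L z = b) :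
    ∃ z, 0 ≤ z ∧ L z = b ∧ ∀ z', 0 ≤ z' → L z' = b → c z ≤ c z' := by
  -- The attainable costs are a slice of a closed cone, so the infimum is itself attainable.
  set V : Set ℝ := {r | (b, r) ∈ Set.image (L.prod c) {z | 0 ≤ z}} with hV
  have hclosed : IsClosed V :=
    (isClosed_image_nonneg (L.prod c)).preimage (by fun_prop)
  have hmem : ∀ z', 0 ≤ z' → L z' = b → c z' ∈ V := fun z' h0 hb => ⟨z', h0, by simp [hb]⟩
  have hbdd : BddBelow V := by
    refine ⟨0, ?_⟩
    rintro r ⟨z, hz, h⟩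
    replace h := Prod.ext_iff.1 h
    exact (hc z hz).trans_eq h.2
  obtain ⟨z₀, h0, hb⟩ := h
  obtain ⟨z, hz, hzeq⟩ := hclosed.csInf_mem ⟨_, hmem z₀ h0 hb⟩ hbdd
  replace hzeq := Prod.ext_iff.1 hzeq
  exact ⟨z, hz, hzeq.1, fun z' h1 h2 => (le_of_eq hzeq.2).trans (csInf_le hbdd (hmem z' h1 h2))⟩

end ConicLP

/-! ### Reduction of the linear program to flows on two copies of the state space -/

namespace CostPA

noncomputable section

variable {S : Type u} {Act : Type v}

/-- In the network for the label `a`, the transition `tr`, taken in the copy `p` of the state space,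
leads to the copy `q`. The copy `false` holds the states reached with the empty trace, the copy
`true` those reached with the trace `a`. -/
def Move (A : PA S Act) (a : Act) (tr : A.Tr) : Bool → Bool → Prop
  | false, false => tr.1.action ∈ A.hidden
  | false, true => a ∉ A.hidden ∧ tr.1.action = a
  | true, true => a ∉ A.hidden ∧ tr.1.action ∈ A.hidden
  | true, false => False

theorem move_false_false {A : PA S Act} {a : Act} {tr : A.Tr} :
    Move A a tr false false ↔ tr.1.action ∈ A.hidden := by simp only [Move]

theorem move_false_true {A : PA S Act} {a : Act} {tr : A.Tr} :
    Move A a tr false true ↔ a ∉ A.hidden ∧ tr.1.action = a := by simp only [Move]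

theorem move_true_true {A : PA S Act} {a : Act} {tr : A.Tr} :
    Move A a tr true true ↔ a ∉ A.hidden ∧ tr.1.action ∈ A.hidden := by simp only [Move]

theorem move_true_false {A : PA S Act} {a : Act} {tr : A.Tr} :
    Move A a tr true false ↔ False := by simp only [Move]

/-- `p` is the copy of the state space in which a weak transition labelled `a` ends. -/
def Final (A : PA S Act) (a : Act) (p : Bool) : Prop := p = true ↔ a ∉ A.hidden

open Classical in
/-- The flow that the transitions send into the copy `p` of the state `w`. -/
def inflow (A : PA S Act) (a : Act) (x : Bool → A.Tr → ℝ≥0) (p : Bool) (w : S) : ℝ≥0 :=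
  ∑ q, ∑ tr : A.Tr, if Move A a tr q p then x q tr * (tr.1.target w).toNNReal else 0

open Classical in
/-- The flow that leaves the copy `p` of the state `w`. -/
def outflow [Fintype S] (A : PA S Act) (a : Act) (x : Bool → A.Tr → ℝ≥0) (y : S → S → ℝ≥0)
    (p : Bool) (w : S) : ℝ≥0 :=
  (∑ tr : A.Tr, if tr.1.source = w then x p tr else 0) + if Final A a p then ∑ u, y u w else 0

open Classical in
/-- Reduced form of the linear program: `x p tr` is the flow through the transition `tr` in the
copy `p`, and `y u w` is the flow through the arc from the final copy of `w` to `u_R`. -/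
structure IsFlow [Fintype S] (A : PA S Act) (t : S) (a : Act) (μ : PMF S) (R : S → S → Prop)
    (x : Bool → A.Tr → ℝ≥0) (y : S → S → ℝ≥0) : Prop where
  support_x : ∀ p tr, (∀ q, ¬ Move A a tr p q) → x p tr = 0
  support_y : ∀ u w, ¬ R u w → y u w = 0
  balance : ∀ p w,
    (if p = false ∧ w = t then 1 else 0) + inflow A a x p w = outflow A a x y p w
  rel : ∀ u, ∑ w, y u w = (μ u).toNNReal

/-- The objective function of the reduced linear program. -/
def flowCost (A : CPA S Act) (x : Bool → A.Tr → ℝ≥0) : ℝ≥0 :=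
  ∑ p, ∑ tr : A.Tr, A.cost tr * x p tr

theorem coe_ite_real (P : Prop) [Decidable P] (b c : ℝ≥0) :
    ((if P then b else c : ℝ≥0) : ℝ) = if P then (b : ℝ) else c := by
  split_ifs <;> rfl

theorem sum_vertex [Fintype S] {A : PA S Act} (g : Vertex A → ℝ) :
    ∑ z, g z = g .source + g .sink + ∑ s, g (.state s) + ∑ m, g (.tr m) + ∑ s, g (.stateA s) +
      ∑ m, g (.trA m) + ∑ s, g (.rel s) := by
  rw [← (Vertex.equivSum A).symm.sum_comp g]
  simp only [Fintype.sum_sum_type, Fintype.sum_bool]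
  simp only [Vertex.equivSum, Equiv.coe_fn_symm_mk]
  ring

/-- The arcs of the network, described by cases on the end points. -/
def ArcCases (A : PA S Act) (t : S) (a : Act) (R : S → S → Prop) : Vertex A → Vertex A → Prop
  | .source, .state s => s = t
  | .rel u, .sink => ∃ w, R u w
  | .state w, .tr m => m.1.action ∈ A.hidden ∧ m.1.source = w
  | .state w, .trA m => a ∉ A.hidden ∧ m.1.action = a ∧ m.1.source = w
  | .stateA w, .trA m => a ∉ A.hidden ∧ m.1.action ∈ A.hidden ∧ m.1.source = w
  | .tr m, .state r => m.1.action ∈ A.hidden ∧ 0 < m.1.target r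
  | .trA m, .stateA r =>
      a ∉ A.hidden ∧ (m.1.action ∈ A.hidden ∨ m.1.action = a) ∧ 0 < m.1.target r
  | .state w, .rel u => a ∈ A.hidden ∧ R u w
  | .stateA w, .rel u => a ∉ A.hidden ∧ R u w
  | _, _ => False

theorem arc_iff {A : PA S Act} {t : S} {a : Act} {R : S → S → Prop} {z z' : Vertex A} :
    Arc A t a R z z' ↔ ArcCases A t a R z z' := by
  constructor
  · rintro h
    cases h <;> simp_all [ArcCases]
    exact ⟨_, ‹_›⟩
  · intro h
    cases z <;> cases z' <;> simp only [ArcCases] at h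
    · subst h; exact .source
    · obtain ⟨h1, rfl⟩ := h; exact .hiddenIn _ h1
    · obtain ⟨h1, h2, rfl⟩ := h; exact .externalIn h1 _ h2
    · exact .relHidden h.1 h.2
    · exact .hiddenOut _ h.1 h.2
    · obtain ⟨h1, h2, rfl⟩ := h; exact .hiddenInA h1 _ h2
    · exact .relExternal h.1 h.2
    · obtain ⟨h1, h2 | h2, h3⟩ := h
      · exact .hiddenOutA h1 _ h2 h3
      · exact .externalOut h1 _ h2 h3
    · exact .sink h.choose_spec

open Classical in
/-- The solution of the linear program that is given by a solution of the reduced one. -/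
def arcFlow (A : PA S Act) (t : S) (a : Act) (μ : PMF S) (x : Bool → A.Tr → ℝ≥0)
    (y : S → S → ℝ≥0) : Vertex A → Vertex A → ℝ
  | .source, .state s => if s = t then 1 else 0
  | .rel u, .sink => (μ u).toReal
  | .state w, .tr m => if m.1.action ∈ A.hidden ∧ m.1.source = w then x false m else 0
  | .state w, .trA m => if a ∉ A.hidden ∧ m.1.action = a ∧ m.1.source = w then x false m else 0
  | .stateA w, .trA m =>
      if a ∉ A.hidden ∧ m.1.action ∈ A.hidden ∧ m.1.source = w then x true m else 0
  | .tr m, .state r => if m.1.action ∈ A.hidden then x false m * (m.1.target r).toReal else 0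
  | .trA m, .stateA r =>
      (if a ∉ A.hidden ∧ m.1.action ∈ A.hidden then x true m * (m.1.target r).toReal else 0) +
      (if a ∉ A.hidden ∧ m.1.action = a then x false m * (m.1.target r).toReal else 0)
  | .state w, .rel u => if a ∈ A.hidden then y u w else 0
  | .stateA w, .rel u => if a ∉ A.hidden then y u w else 0
  | _, _ => 0

theorem arcFlow_nonneg {A : PA S Act} {x : Bool → A.Tr → ℝ≥0} {y : S → S → ℝ≥0} {t : S} {a : Act}
    {μ : PMF S} (z z' : Vertex A) :
    0 ≤ arcFlow A t a μ x y z z' := by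
  unfold arcFlow
  split <;> positivity

/-- The hypothesis on `μ` is needed because `arcFlow` puts `μ u` on the pair from `u_R` to the sink,
which is an arc only if `u` is related to some state. -/
theorem arcFlow_support {A : PA S Act} {t : S} {a : Act} {μ : PMF S} {R : S → S → Prop}
    {x : Bool → A.Tr → ℝ≥0} {y : S → S → ℝ≥0}
    (hy : ∀ u w, ¬ R u w → y u w = 0) (hμ : ∀ u, (∀ w, ¬ R u w) → μ u = 0) (z z' : Vertex A)
    (h : ¬ Arc A t a R z z') : arcFlow A t a μ x y z z' = 0 := by
  rw [arc_iff] at h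
  cases z <;> cases z' <;> simp only [ArcCases, arcFlow] at h ⊢ <;> try simp_all
  grind [ENNReal.toReal_zero]

section

variable [Fintype S] {A : PA S Act} {t : S} {a : Act} {μ : PMF S} {R : S → S → Prop}

open Classical in
theorem sum_arc_in {f : Vertex A → Vertex A → ℝ} (hf : ∀ z z', ¬ Arc A t a R z z' → f z z' = 0)
    (z : Vertex A) : ∑ z' with Arc A t a R z' z, f z' z = ∑ z', f z' z :=
  Finset.sum_filter_of_ne fun _ _ h => not_not.1 (mt (hf _ _) h)

open Classical in
theorem sum_arc_out {f : Vertex A → Vertex A → ℝ}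
    (hf : ∀ z z', ¬ Arc A t a R z z' → f z z' = 0)
    (z : Vertex A) : ∑ z' with Arc A t a R z z', f z z' = ∑ z', f z z' :=
  Finset.sum_filter_of_ne fun _ _ h => not_not.1 (mt (hf _ _) h)

theorem sum_target_toReal (ρ : PMF S) : ∑ s, (ρ s).toReal = 1 := by
  rw [← ENNReal.toReal_sum fun s _ => ρ.apply_ne_top s, ← tsum_fintype (L := .unconditional S),
    ρ.tsum_coe, ENNReal.toReal_one]

variable {x : Bool → A.Tr → ℝ≥0} {y : S → S → ℝ≥0}

open Classical in
theorem sum_arcFlow_into_state (w : S) : ∑ z, arcFlow A t a μ x y z (.state w) =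
    (if w = t then 1 else 0) + (inflow A a x false w : ℝ) := by
  simp [sum_vertex, arcFlow, inflow, move_false_false, move_true_false, coe_ite_real]
  rfl

open Classical in
-- `outflow` counts all transitions leaving `w`, the network only those that are internal or
-- labelled `a`; the support condition makes the others contribute zero.
theorem sum_arcFlow_out_state (hx : ∀ p tr, (∀ q, ¬ Move A a tr p q) → x p tr = 0) (w : S) :
    ∑ z, arcFlow A t a μ x y (.state w) z = (outflow A a x y false w : ℝ) := by
  simp [sum_vertex, arcFlow, outflow, Final, coe_ite_real]
  refine Finset.sum_add_distrib.symm.trans (Finset.sum_congr rfl fun m _ => ?_)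
  have := hx false m
  simp [Move] at this
  by_cases ha : a ∈ A.hidden <;> by_cases hm : m.1.action ∈ A.hidden <;>
    by_cases hm' : m.1.action = a <;> simp_all

open Classical in
theorem sum_arcFlow_into_stateA (w : S) : ∑ z, arcFlow A t a μ x y z (.stateA w) =
    (inflow A a x true w : ℝ) := by
  simp [sum_vertex, arcFlow, inflow, move_false_true, move_true_true, coe_ite_real,
    Finset.sum_add_distrib]
  rfl

open Classical in
theorem sum_arcFlow_out_stateA (hx : ∀ p tr, (∀ q, ¬ Move A a tr p q) → x p tr = 0) (w : S) :
    ∑ z, arcFlow A t a μ x y (.stateA w) z = (outflow A a x y true w : ℝ) := by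
  simp [sum_vertex, arcFlow, outflow, Final, coe_ite_real]
  refine Finset.sum_congr rfl fun m _ => ?_
  have := hx true m
  simp [Move] at this
  by_cases ha : a ∈ A.hidden <;> by_cases hm : m.1.action ∈ A.hidden <;>
    by_cases hm' : m.1.action = a <;> simp_all

open Classical in
theorem sum_arcFlow_into_tr (m : A.Tr) : ∑ z, arcFlow A t a μ x y z (.tr m) =
    if m.1.action ∈ A.hidden then (x false m : ℝ) else 0 := by
  simp [sum_vertex, arcFlow, ite_and]

open Classical in
theorem sum_arcFlow_out_tr (m : A.Tr) : ∑ z, arcFlow A t a μ x y (.tr m) z =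
    if m.1.action ∈ A.hidden then (x false m : ℝ) else 0 := by
  simp [sum_vertex, arcFlow, ← Finset.mul_sum, sum_target_toReal]

open Classical in
theorem sum_arcFlow_trA (m : A.Tr) : ∑ z, arcFlow A t a μ x y z (.trA m) =
    ∑ z, arcFlow A t a μ x y (.trA m) z := by
  by_cases ha : a ∈ A.hidden <;> by_cases hm : m.1.action ∈ A.hidden <;>
    by_cases hm' : m.1.action = a <;>
    simp [sum_vertex, arcFlow, ha, hm, hm', ← Finset.mul_sum, sum_target_toReal, add_comm]

open Classical in
theorem sum_arcFlow_into_rel (u : S) : ∑ z, arcFlow A t a μ x y z (.rel u) =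
    ∑ w, (y u w : ℝ) := by
  by_cases ha : a ∈ A.hidden <;> simp [sum_vertex, arcFlow, ha]

open Classical in
theorem sum_arcFlow_out_rel (u : S) : ∑ z, arcFlow A t a μ x y (.rel u) z = (μ u).toReal := by
  simp [sum_vertex, arcFlow]

open Classical in
/-- A solution of the reduced linear program yields a solution of the linear program. -/
theorem IsFlow.feasible (h : IsFlow A t a μ R x y) :
    Feasible A t a μ R (arcFlow A t a μ x y) := by
  have hsupp := arcFlow_support (t := t) (a := a) (x := x) (μ := μ) h.support_y fun u hu => by
    have := h.rel u
    simp only [fun w => h.support_y u w (hu w), Finset.sum_const_zero] at this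
    simpa [ENNReal.toNNReal_eq_zero_iff, μ.apply_ne_top] using this.symm
  refine ⟨hsupp, fun _ _ _ => arcFlow_nonneg _ _, by simp [arcFlow], fun u => rfl, ?_, ?_, ?_, ?_⟩
  · intro z hz h1 h2
    rw [sum_arc_in hsupp, sum_arc_out hsupp, sub_eq_zero]
    cases z with
    | source => simp at h1
    | sink => simp at h2
    | state w =>
      rw [sum_arcFlow_into_state, sum_arcFlow_out_state h.support_x, ← h.balance]
      simp [coe_ite_real]
    | tr m => rw [sum_arcFlow_into_tr, sum_arcFlow_out_tr]
    | stateA w =>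
      rw [sum_arcFlow_into_stateA, sum_arcFlow_out_stateA h.support_x, ← h.balance]
      simp
    | trA m => exact sum_arcFlow_trA m
    | rel u =>
      rw [sum_arcFlow_into_rel, sum_arcFlow_out_rel, ← NNReal.coe_sum, h.rel]; rfl
  · intro m hm r hr
    simp [arcFlow, hm, mul_comm]
  · intro ha m hm r hr
    -- An internal label differs from the external `a`, so only one of the two summands of `arcFlow`
    -- on this arc survives.
    have : m.1.action ≠ a := fun h => ha (h ▸ hm)
    simp [arcFlow, hm, mul_comm, ha, this]
  · intro ha m hm r hr
    have : m.1.action ∉ A.hidden := fun h => ha (hm ▸ h)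
    simp [arcFlow, hm, mul_comm, ha]

open Classical in
/-- Every solution of the linear program comes from a solution of the reduced one. -/
theorem Feasible.exists_isFlow {f : Vertex A → Vertex A → ℝ} (h : Feasible A t a μ R f) :
    ∃ x y, IsFlow A t a μ R x y ∧ f = arcFlow A t a μ x y := by
  have h0 : ∀ z z', 0 ≤ f z z' := fun z z' => by
    by_cases hz : Arc A t a R z z'
    · exact h.nonneg _ _ hz
    · exact (h.support _ _ hz).ge
  -- In the copy `false`, a transition has at most one incoming arc: to `v^tr` if it is internal, to
  -- `v^tr_a` if it carries the external label `a`.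
  let x : Bool → A.Tr → ℝ≥0 := fun p m =>
    match p with
    | false =>
      if m.1.action ∈ A.hidden then (f (.state m.1.source) (.tr m)).toNNReal else
        (f (.state m.1.source) (.trA m)).toNNReal
    | true => (f (.stateA m.1.source) (.trA m)).toNNReal
  let y : S → S → ℝ≥0 := fun u w =>
    if a ∈ A.hidden then (f (.state w) (.rel u)).toNNReal else
      (f (.stateA w) (.rel u)).toNNReal
  have hsupp : ∀ z z', ¬ ArcCases A t a R z z' → f z z' = 0 :=
    fun z z' hz => h.support z z' (mt arc_iff.1 hz)
  -- The proportionality constraints are imposed only where the target probability is positive;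
  -- elsewhere there is no arc and both sides vanish.
  have hmul : ∀ (m : A.Tr) (r : S) (b c : ℝ), (m.1.target r = 0 → b = 0) →
      (0 < m.1.target r → b - (m.1.target r).toReal * c = 0) →
      b = c * (m.1.target r).toReal := by
    intro m r b c h1 h2
    rcases eq_or_ne (m.1.target r) 0 with h | h
    · simp [h, h1 h]
    · linarith [h2 (pos_iff_ne_zero.2 h)]
  have heq : f = arcFlow A t a μ x y := by
    funext z z'
    have hs := hsupp z z'
    cases z <;> cases z' <;> simp only [ArcCases] at hs <;>
      simp only [arcFlow, x, y] <;> try exact hs not_false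
    case source.state s =>
      split_ifs with hc
      · rw [hc]; exact h.source
      · exact hs hc
    case state.tr w m => split_ifs <;> grind [Real.coe_toNNReal]
    case state.trA w m => split_ifs <;> grind [Real.coe_toNNReal]
    case state.rel w u => split_ifs <;> grind [Real.coe_toNNReal]
    case stateA.trA w m => split_ifs <;> grind [Real.coe_toNNReal]
    case stateA.rel w u => split_ifs <;> grind [Real.coe_toNNReal]
    case rel.sink u => exact h.sink u
    case tr.state m r =>
      split_ifs with hm
      · rw [Real.coe_toNNReal _ (h0 _ _)]
        exact hmul m r _ _ (fun h' => hs (by simp [h'])) (h.balanceHidden m hm r)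
      · exact hs (by simp [hm])
    case trA.stateA m r =>
      by_cases ha : a ∈ A.hidden
      · simp [hs, ha]
      by_cases hm : m.1.action ∈ A.hidden
      · have : m.1.action ≠ a := fun h => ha (h ▸ hm)
        simp only [ha, hm, this, Real.coe_toNNReal _ (h0 _ _)]
        simpa using hmul m r _ _ (fun h' => hs (by simp [h'])) (h.balanceHiddenA ha m hm r)
      by_cases hm' : m.1.action = a
      · simp only [ha, hm', if_false, Real.coe_toNNReal _ (h0 _ _)]
        simpa using hmul m r _ _ (fun h' => hs (by simp [h'])) (h.balanceExternal ha m hm' r)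
      · simpa [hm, hm'] using hs
  have hx : ∀ p tr, (∀ q, ¬ Move A a tr p q) → x p tr = 0 := by
    rintro (_ | _) m hm
    · simp [Move] at hm
      simp [x, hm.1]
      rw [hsupp]
      simpa [ArcCases] using hm.2
    · simp [Move] at hm
      simp [x]
      rw [hsupp]
      simpa [ArcCases] using hm
  refine ⟨x, y, ⟨hx, ?_, ?_, ?_⟩, heq⟩
  · intro u w hu
    simp only [y]
    rw [hsupp, hsupp] <;> simp [ArcCases, hu]
  · rintro (_ | _) w
    · have := h.conservation (.state w) trivial (by simp) (by simp)
      rw [sum_arc_in h.support, sum_arc_out h.support, sub_eq_zero, heq, sum_arcFlow_into_state,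
        sum_arcFlow_out_state hx] at this
      rw [← NNReal.coe_inj, ← this]
      simp [coe_ite_real]
    -- For internal `a` the program has no vertex `v_a` and no conservation law there; the second
    -- copy carries no flow and the balance is trivial.
    · by_cases ha : a ∈ A.hidden
      · have hx' : ∀ m, x true m = 0 := fun m => hx true m (by simp [Move, ha])
        simp [inflow, outflow, hx', Final, ha, move_false_true]
      have := h.conservation (.stateA w) ha (by simp) (by simp)
      rw [sum_arc_in h.support, sum_arc_out h.support, sub_eq_zero, heq, sum_arcFlow_into_stateA,
        sum_arcFlow_out_stateA hx] at this
      rw [← NNReal.coe_inj, ← this]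
      simp
  · intro u
    have := h.conservation (.rel u) trivial (by simp) (by simp)
    rw [sum_arc_in h.support, sum_arc_out h.support, sub_eq_zero, heq, sum_arcFlow_into_rel,
        sum_arcFlow_out_rel] at this
    rw [← NNReal.coe_inj, NNReal.coe_sum, this]; rfl

open Classical in
-- Each transition pays at most once per copy, on its incoming arc; where there is no such arc, `x`
-- vanishes by the support condition.
theorem objective_arcFlow {A : CPA S Act} {x : Bool → A.Tr → ℝ≥0}
    (h : IsFlow A.toPA t a μ R x y) :
    objective A t a R (arcFlow A.toPA t a μ x y) = flowCost A x := by
  have hsupp := h.feasible.support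
  rw [objective, Finset.sum_filter_of_ne, Fintype.sum_prod_type]
  · simp [sum_vertex, arcFlow, arcCost, flowCost]
    simp only [Finset.sum_add_distrib]
    rw [Finset.sum_comm, Finset.sum_comm (s := Finset.univ), Finset.sum_comm (s := Finset.univ),
      ← Finset.sum_add_distrib, ← Finset.sum_add_distrib, ← Finset.sum_add_distrib]
    refine Finset.sum_congr rfl fun m _ => ?_
    have hf := h.support_x false m
    have ht := h.support_x true m
    simp only [Bool.forall_bool, move_false_false, move_false_true, move_true_true,
      move_true_false, not_false_eq_true, true_and] at hf ht
    by_cases ha : a ∈ A.hidden <;> by_cases hm : m.1.action ∈ A.hidden <;>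
      by_cases hm' : m.1.action = a <;> simp_all [add_comm]
  · intro z _ hz
    by_contra hc
    exact hz (by rw [hsupp _ _ hc, mul_zero])

end

end

/-! ### The reduced program as a linear system: optima and limits -/

noncomputable section

variable {S : Type u} {Act : Type v}

open Filter Topology

variable {A : PA S Act}

/-- A pair of flow functions as a single vector. -/
def flowVector (x : Bool → A.Tr → ℝ≥0) (y : S → S → ℝ≥0) : (Bool × A.Tr) ⊕ (S × S) → ℝ :=
  Sum.elim (fun m => x m.1 m.2) fun e => y e.1 e.2

theorem flowVector_nonneg (x : Bool → A.Tr → ℝ≥0) (y : S → S → ℝ≥0) : 0 ≤ flowVector x y := by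
  rintro (_ | _) <;> simp [flowVector]

theorem exists_flowVector_eq {z : (Bool × A.Tr) ⊕ (S × S) → ℝ} (hz : 0 ≤ z) :
    ∃ x y, z = flowVector x y := by
  refine ⟨fun p m => (z (.inl (p, m))).toNNReal, fun u w => (z (.inr (u, w))).toNNReal, ?_⟩
  ext (i | i) <;> simp [flowVector, Real.coe_toNNReal _ (hz _)]

/-- The objective function of the reduced linear program as a linear form. -/
def costForm (c : A.Tr → ℝ≥0) : ((Bool × A.Tr) ⊕ (S × S) → ℝ) →ₗ[ℝ] ℝ where
  toFun z := ∑ p, ∑ m : A.Tr, c m * z (.inl (p, m))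
  map_add' z z' := by simp [mul_add, Finset.sum_add_distrib]
  map_smul' k z := by
    simp only [Pi.smul_apply, smul_eq_mul, RingHom.id_apply, Finset.mul_sum, mul_left_comm]

theorem costForm_nonneg (c : A.Tr → ℝ≥0) (z : (Bool × A.Tr) ⊕ (S × S) → ℝ) (hz : 0 ≤ z) :
    0 ≤ costForm c z := by
  have h : ∀ p (m : A.Tr), 0 ≤ (c m : ℝ) * z (.inl (p, m)) :=
    fun p m => mul_nonneg (c m).2 (hz (.inl (p, m)))
  simp only [costForm, LinearMap.coe_mk, AddHom.coe_mk]
  exact Finset.sum_nonneg fun p _ => Finset.sum_nonneg fun m _ => h p m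

theorem costForm_flowVector {x : Bool → A.Tr → ℝ≥0} {y : S → S → ℝ≥0} (c : A.Tr → ℝ≥0) :
    costForm c (flowVector x y) = ((∑ p, ∑ m : A.Tr, c m * x p m : ℝ≥0) : ℝ) := by
  simp [costForm, flowVector]

section

variable [Fintype S] (A) (t : S) (a : Act) (μ : PMF S) (R : S → S → Prop)

open Classical in
/-- The left-hand sides of the equality constraints of the reduced linear program. -/
def constraintMap : ((Bool × A.Tr) ⊕ (S × S) → ℝ) →ₗ[ℝ]
    (Bool × S → ℝ) × (S → ℝ) × (Bool × A.Tr → ℝ) × (S × S → ℝ) where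
  toFun z :=
    (fun n => (∑ m : A.Tr, if m.1.source = n.2 then z (.inl (n.1, m)) else 0) +
        (if Final A a n.1 then ∑ u, z (.inr (u, n.2)) else 0) -
        ∑ q, ∑ m : A.Tr,
          if Move A a m q n.1 then z (.inl (q, m)) * (m.1.target n.2).toReal else 0,
      fun u => ∑ w, z (.inr (u, w)),
      fun m => if ∀ q, ¬ Move A a m.2 m.1 q then z (.inl m) else 0,
      fun e => if ¬ R e.1 e.2 then z (.inr e) else 0)
  map_add' z z' := by
    ext n
    · simp only [Pi.add_apply, add_mul, ite_add_zero, Finset.sum_add_distrib, Prod.fst_add]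
      ring
    · simp only [Pi.add_apply, Finset.sum_add_distrib, Prod.fst_add, Prod.snd_add]
    · simp only [Pi.add_apply, ite_add_zero, Prod.fst_add, Prod.snd_add]
    · simp only [Pi.add_apply, ite_add_zero, Prod.snd_add]
  map_smul' c z := by
    ext n
    · simp only [Pi.smul_apply, smul_eq_mul, RingHom.id_apply, Prod.smul_fst, mul_sub, mul_add,
        Finset.mul_sum, mul_ite, mul_zero, mul_assoc]
    · simp [Finset.mul_sum]
    · simp
    · simp

open Classical in
/-- The right-hand sides of the equality constraints of the reduced linear program. -/
def constraintValue : (Bool × S → ℝ) × (S → ℝ) × (Bool × A.Tr → ℝ) × (S × S → ℝ) :=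
  (fun n => if n.1 = false ∧ n.2 = t then 1 else 0, fun u => (μ u).toReal, 0, 0)

variable {A}

variable {t a μ R} {x : Bool → A.Tr → ℝ≥0} {y : S → S → ℝ≥0}

open Classical in
theorem constraintMap_flowVector : constraintMap A a R (flowVector x y) =
    (fun n => (outflow A a x y n.1 n.2 : ℝ) - inflow A a x n.1 n.2,
      fun u => ∑ w, (y u w : ℝ),
      fun m => if ∀ q, ¬ Move A a m.2 m.1 q then (x m.1 m.2 : ℝ) else 0,
      fun e => if ¬ R e.1 e.2 then (y e.1 e.2 : ℝ) else 0) := by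
  simp only [constraintMap, flowVector, outflow, inflow, LinearMap.coe_mk, AddHom.coe_mk,
    Sum.elim_inl, Sum.elim_inr, NNReal.coe_add, NNReal.coe_sum, coe_ite_real, NNReal.coe_mul,
    NNReal.coe_zero]
  rfl

open Classical in
theorem isFlow_iff : IsFlow A t a μ R x y ↔
    constraintMap A a R (flowVector x y) = constraintValue A t μ := by
  rw [constraintMap_flowVector]
  simp only [constraintValue, Prod.mk.injEq, funext_iff, Prod.forall, sub_eq_iff_eq_add,
    Pi.zero_apply]
  constructor
  · intro h
    refine ⟨fun p w => ?_, fun u => ?_, fun p m => ?_, fun u w => ?_⟩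
    · rw [← h.balance]
      simp [coe_ite_real]
    · rw [← NNReal.coe_sum, h.rel]; rfl
    · split_ifs with hm
      · simp [h.support_x p m hm]
      · rfl
    · split_ifs with hR
      · rfl
      · simp [h.support_y u w hR]
  · rintro ⟨h1, h2, h3, h4⟩
    refine ⟨fun p m hm => ?_, fun u w hR => ?_, fun p w => ?_, fun u => ?_⟩
    · simpa [hm] using h3 p m
    · simpa [hR] using h4 u w
    · rw [← NNReal.coe_inj, h1]
      simp [coe_ite_real]
    · rw [← NNReal.coe_inj, NNReal.coe_sum, h2]; rfl

theorem IsFlow.exists_optimal (h : IsFlow A t a μ R x y) (c : A.Tr → ℝ≥0) :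
    ∃ x₀ y₀, IsFlow A t a μ R x₀ y₀ ∧ ∀ x' y', IsFlow A t a μ R x' y' →
      ∑ p, ∑ m : A.Tr, c m * x₀ p m ≤ ∑ p, ∑ m : A.Tr, c m * x' p m := by
  obtain ⟨z, hz, hb, hmin⟩ := ConicLP.exists_optimal (constraintMap A a R) (costForm c)
    (costForm_nonneg c) ⟨_, flowVector_nonneg x y, isFlow_iff.1 h⟩
  obtain ⟨x₀, y₀, rfl⟩ := exists_flowVector_eq hz
  refine ⟨x₀, y₀, isFlow_iff.2 hb, fun x' y' h' => ?_⟩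
  have := hmin _ (flowVector_nonneg x' y') (isFlow_iff.1 h')
  rwa [costForm_flowVector, costForm_flowVector, NNReal.coe_le_coe] at this

open Classical in
/-- Approximate solutions of the reduced linear program with bounded cost yield an exact one. -/
theorem exists_isFlow_of_tendsto {x : ℕ → Bool → A.Tr → ℝ≥0}
    (support_x : ∀ n p tr, (∀ q, ¬ Move A a tr p q) → x n p tr = 0)
    (support_y : ∀ u w, ¬ R u w → y u w = 0)
    (balance : ∀ p w, Tendsto (fun n => (outflow A a (x n) y p w : ℝ) - inflow A a (x n) p w) atTop
      (𝓝 (if p = false ∧ w = t then 1 else 0)))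
    (rel : ∀ u, ∑ w, y u w = (μ u).toNNReal) (c : A.Tr → ℝ≥0) (K : ℝ≥0)
    (hK : ∀ n, ∑ p, ∑ m : A.Tr, c m * x n p m ≤ K) :
    ∃ x₀ y₀, IsFlow A t a μ R x₀ y₀ ∧ ∑ p, ∑ m : A.Tr, c m * x₀ p m ≤ K := by
  -- Only the balance component really converges; the other three hold exactly for every `n`.
  have hlim : Tendsto (fun n => constraintMap A a R (flowVector (x n) y)) atTop
      (𝓝 (constraintValue A t μ)) := by
    simp only [constraintMap_flowVector]
    refine Tendsto.prodMk_nhds (tendsto_pi_nhds.2 fun n => balance n.1 n.2)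
      (Tendsto.prodMk_nhds (tendsto_pi_nhds.2 fun u => ?_)
        (Tendsto.prodMk_nhds (tendsto_pi_nhds.2 fun m => ?_) (tendsto_pi_nhds.2 fun e => ?_)))
    · rw [← NNReal.coe_sum, rel]
      exact tendsto_const_nhds
    · refine tendsto_const_nhds.congr fun n => ?_
      split_ifs with h
      · simp [support_x n _ _ h]
      · rfl
    · refine tendsto_const_nhds.congr fun n => ?_
      split_ifs with h
      · rfl
      · simp [support_y _ _ h]
  obtain ⟨z, hz, hb, hc⟩ := ConicLP.exists_nonneg_of_tendsto (constraintMap A a R) (costForm c)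
    (costForm_nonneg c) (K := K) (fun n => flowVector_nonneg (x n) y) hlim fun n => by
      rw [costForm_flowVector]; exact_mod_cast hK n
  obtain ⟨x₀, y₀, rfl⟩ := exists_flowVector_eq hz
  rw [costForm_flowVector] at hc
  exact ⟨x₀, y₀, isFlow_iff.2 hb, by exact_mod_cast hc⟩

end

end

/-! ### Expectations over execution fragments of a given length -/

noncomputable section

variable {S : Type u} {Act : Type v}

open Filter Topology

variable {A : PA S Act}

/-- The number of steps of a finite execution fragment. -/
def Frag.length : {s : S} → Frag A s → ℕ
  | _, .single _ => 0
  | _, .snoc α _ _ _ => α.length + 1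

variable (A) in
/-- The finite execution fragments with `n` steps. -/
abbrev Level (n : ℕ) : Type (max u v) := {α : (s : S) × Frag A s // α.2.length = n}

variable (A) in
/-- The pairs of an action and a state by which a fragment that ends in `s` can be extended. -/
abbrev Ext (s : S) : Type (max u v) :=
  {e : Act × S // ∃ tr ∈ A.trans, tr.source = s ∧ tr.action = e.1 ∧ 0 < tr.target e.2}

/-- A fragment with no step is a state. -/
def levelZeroEquiv : S ≃ Level A 0 where
  toFun s := ⟨⟨s, .single s⟩, rfl⟩
  invFun α := α.1.1
  left_inv _ := rfl
  right_inv := by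
    rintro ⟨⟨s, _ | _⟩, h⟩
    · rfl
    · simp [Frag.length] at h

/-- A fragment with `n + 1` steps extends a fragment with `n` steps. -/
def levelSuccEquiv (n : ℕ) : ((α : Level A n) × Ext A α.1.1) ≃ Level A (n + 1) where
  toFun p := ⟨⟨p.2.1.2, .snoc p.1.1.2 p.2.1.1 p.2.1.2 p.2.2⟩, by simp [Frag.length, p.1.2]⟩
  invFun
    | ⟨⟨_, .single _⟩, h⟩ => absurd h (by simp [Frag.length])
    | ⟨⟨_, .snoc α b r e⟩, h⟩ => ⟨⟨⟨_, α⟩, by simpa [Frag.length] using h⟩, ⟨(b, r), e⟩⟩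
  left_inv _ := rfl
  right_inv := by
    rintro ⟨⟨s, _ | _⟩, h⟩
    · simp [Frag.length] at h
    · rfl

/-- The expectation of `φ` over the fragments with `n` steps, weighted by their cones. -/
def expect (σ : Scheduler A) (t : S) (n : ℕ) (φ : ((s : S) × Frag A s) → ℝ≥0∞) : ℝ≥0∞ :=
  ∑' α : Level A n, σ.cone t α.1.2 * φ α.1

variable {σ : Scheduler A} {t : S} {n : ℕ}

theorem expect_zero (φ : ((s : S) × Frag A s) → ℝ≥0∞) :
    expect σ t 0 φ = φ ⟨t, .single t⟩ := by
  classical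
  rw [expect, ← (levelZeroEquiv (A := A)).tsum_eq, tsum_eq_single t]
  · simp [levelZeroEquiv, Scheduler.cone]
  · intro s hs
    simp [levelZeroEquiv, Scheduler.cone, hs]

theorem expect_mono {φ ψ : ((s : S) × Frag A s) → ℝ≥0∞} (h : ∀ α, φ α ≤ ψ α) :
    expect σ t n φ ≤ expect σ t n ψ :=
  ENNReal.tsum_le_tsum fun _ => by gcongr; exact h _

theorem expect_congr {φ ψ : ((s : S) × Frag A s) → ℝ≥0∞} (h : ∀ α, φ α = ψ α) :
    expect σ t n φ = expect σ t n ψ := by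
  rw [funext h]

theorem expect_add (φ ψ : ((s : S) × Frag A s) → ℝ≥0∞) :
    expect σ t n (fun α => φ α + ψ α) = expect σ t n φ + expect σ t n ψ := by
  simp only [expect, mul_add, ENNReal.tsum_add]

theorem expect_sum {ι : Type*} (s : Finset ι) (φ : ι → ((s : S) × Frag A s) → ℝ≥0∞) :
    expect σ t n (fun α => ∑ i ∈ s, φ i α) = ∑ i ∈ s, expect σ t n (φ i) := by
  simp only [expect, Finset.mul_sum]
  exact Summable.tsum_finsetSum fun _ _ => ENNReal.summable

theorem expect_mul_const (φ : ((s : S) × Frag A s) → ℝ≥0∞) (c : ℝ≥0∞) :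
    expect σ t n (fun α => φ α * c) = expect σ t n φ * c := by
  simp only [expect, ← mul_assoc, ENNReal.tsum_mul_right]

theorem tsum_expect (φ : ((s : S) × Frag A s) → ℝ≥0∞) :
    ∑' n, expect σ t n φ = ∑' α : (s : S) × Frag A s, σ.cone t α.2 * φ α := by
  rw [← (Equiv.sigmaFiberEquiv fun α : (s : S) × Frag A s => α.2.length).tsum_eq,
    ENNReal.tsum_sigma']
  rfl

theorem cone_eq_zero_of_expect_eq_zero {φ : ((s : S) × Frag A s) → ℝ≥0∞}
    (h : ∀ n, expect σ t n φ = 0) {s : S} (α : Frag A s) (hα : φ ⟨s, α⟩ ≠ 0) :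
    σ.cone t α = 0 := by
  have := ENNReal.tsum_eq_zero.1 (h α.length) ⟨⟨s, α⟩, rfl⟩
  simpa [hα] using this

theorem step_eq_zero {s : S} (α : Frag A s) {b : Act} {r : S}
    (h : ¬ ∃ tr ∈ A.trans, tr.source = s ∧ tr.action = b ∧ 0 < tr.target r) :
    σ.step α b r = 0 := by
  classical
  refine Finset.sum_eq_zero fun tr htr => ?_
  by_contra hne
  obtain ⟨h1, h2⟩ := mul_ne_zero_iff.1 hne
  exact h ⟨tr.1, tr.2, σ.enabled α tr (pos_iff_ne_zero.2 h1), (Finset.mem_filter.1 htr).2,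
    pos_iff_ne_zero.2 h2⟩

variable [Fintype S]

/-- The set of actions may be infinite, but `step` vanishes on the pairs that extend no fragment.
The sum can therefore be taken over all pairs and regrouped by the finitely many transitions. -/
theorem tsum_step_mul {s : S} (α : Frag A s) (ψ : Act → S → ℝ≥0∞) :
    ∑' e : Ext A s, σ.step α e.1.1 e.1.2 * ψ e.1.1 e.1.2 =
      ∑ tr : A.Tr, σ.choice α (some tr) * ∑ r, tr.1.target r * ψ tr.1.action r := by
  classical
  refine (tsum_subtype_eq_of_support_subset
    (f := fun e : Act × S => σ.step α e.1 e.2 * ψ e.1 e.2)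
    (s := {e | ∃ tr ∈ A.trans, tr.source = s ∧ tr.action = e.1 ∧ 0 < tr.target e.2}) ?_).trans ?_
  · intro e he
    by_contra h
    exact he (by simp only; rw [step_eq_zero α h, zero_mul])
  · have hb : ∀ b r, σ.step α b r * ψ b r = ∑ tr : A.Tr,
        if b = tr.1.action then
          σ.choice α (some tr) * (tr.1.target r * ψ tr.1.action r) else 0 := by
      intro b r
      rw [Scheduler.step, Finset.sum_mul, Finset.sum_filter]
      refine Finset.sum_congr rfl fun tr _ => ?_
      by_cases h : tr.1.action = b
      · simp [h, mul_assoc]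
      · simp [h, Ne.symm h]
    rw [ENNReal.tsum_prod']
    simp only [tsum_fintype, hb]
    rw [Summable.tsum_finsetSum fun _ _ => ENNReal.summable]
    simp only [Finset.mul_sum]
    rw [Finset.sum_comm]
    refine Finset.sum_congr rfl fun r _ => ?_
    rw [Summable.tsum_finsetSum fun _ _ => ENNReal.summable]
    simp only [tsum_ite_eq]

/-- Conditioning on the last step. The function `ψ` records how `φ` on an extended fragment depends
on the prefix, the action and the new state; all recursions in time below are instances. -/
theorem expect_succ {φ : ((s : S) × Frag A s) → ℝ≥0∞} (ψ : ((s : S) × Frag A s) → Act → S → ℝ≥0∞)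
    (h : ∀ s (α : Frag A s) b r e, φ ⟨r, .snoc α b r e⟩ = ψ ⟨s, α⟩ b r) :
    expect σ t (n + 1) φ = expect σ t n fun α =>
      ∑ tr : A.Tr, σ.choice α.2 (some tr) * ∑ r, tr.1.target r * ψ α tr.1.action r := by
  rw [expect, ← (levelSuccEquiv n).tsum_eq, ENNReal.tsum_sigma']
  refine tsum_congr fun α => ?_
  simp only
  rw [← tsum_step_mul, ← ENNReal.tsum_mul_left]
  refine tsum_congr fun e => ?_
  simp only [levelSuccEquiv, Equiv.coe_fn_mk, Scheduler.cone, h, mul_assoc]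

end

/-! ### Occupation, usage and stopping probabilities in the two copies -/

noncomputable section

variable {S : Type u} {Act : Type v}

open Filter Topology

variable {A : PA S Act}

/-- The trace of the executions that have reached the copy `p` of the state space. -/
def phaseTrace (a : Act) (p : Bool) : List Act := if p then [a] else []

theorem phaseTrace_injective (a : Act) : Function.Injective (phaseTrace a) := by
  rintro (_ | _) (_ | _) <;> simp [phaseTrace]

theorem final_iff {a : Act} {p : Bool} : Final A a p ↔ actTrace A a = phaseTrace a p := by
  by_cases ha : a ∈ A.hidden <;> cases p <;> simp [Final, actTrace, phaseTrace, ha]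

theorem exists_final (A : PA S Act) (a : Act) : ∃ p, Final A a p := by
  by_cases ha : a ∈ A.hidden
  · exact ⟨false, by simp [Final, ha]⟩
  · exact ⟨true, by simp [Final, ha]⟩

/-- `phaseTrace a true` is `[a]` even for internal `a`; this lemma ensures that no fragment has that
trace then. -/
theorem Frag.not_hidden_of_mem_trace {s : S} (α : Frag A s) : ∀ b ∈ α.trace, b ∉ A.hidden := by
  induction α with
  | single s => simp [Frag.trace]
  | snoc α b r h ih =>
    intro c hc
    rw [Frag.trace, List.mem_append] at hc
    rcases hc with hc | hc
    · exact ih c hc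
    · by_cases hb : b ∈ A.hidden
      · simp [actTrace, hb] at hc
      · simp only [actTrace, hb, if_false, List.mem_singleton] at hc
        exact hc ▸ hb

/-- A step ending in a copy must have started in a copy, and `Move` lists the possibilities. In
particular, an execution that has left the copies cannot return. -/
theorem append_actTrace_eq_phaseTrace_iff {a : Act} {p : Bool} {l : List Act} (tr : A.Tr)
    (hl : ∀ b ∈ l, b ∉ A.hidden) : l ++ actTrace A tr.1.action = phaseTrace a p ↔
      ∃ q, Move A a tr q p ∧ l = phaseTrace a q := by
  by_cases hb : tr.1.action ∈ A.hidden
  · have hne : l = [a] → a ∉ A.hidden := fun h => hl a (by simp [h])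
    have hne' : tr.1.action = a → a ∈ A.hidden := fun h => h ▸ hb
    cases p <;> simp only [actTrace, phaseTrace, hb, Bool.exists_bool, move_false_false,
      move_false_true, move_true_true, move_true_false, if_true, List.append_nil,
      Bool.false_eq_true, if_false] <;> tauto
  · cases p
    · simp [actTrace, phaseTrace, hb, move_false_false, move_true_false]
    · simp only [actTrace, phaseTrace, hb, Bool.exists_bool, move_false_true, move_true_true,
        if_true, Bool.false_eq_true, if_false, and_false, false_and, or_false]
      rw [List.append_eq_singleton_iff]
      constructor
      · rintro (⟨h1, h2⟩ | ⟨_, h⟩)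
        · simp only [List.cons.injEq, and_true] at h2
          exact ⟨⟨h2 ▸ hb, h2⟩, h1⟩
        · simp at h
      · rintro ⟨⟨_, h⟩, h'⟩
        exact .inl ⟨h', by rw [h]⟩

theorem choice_none_add_sum (σ : Scheduler A) {s : S} (α : Frag A s) :
    σ.choice α none + ∑ tr : A.Tr, σ.choice α (some tr) = 1 := by
  rw [← (σ.choice α).tsum_coe, tsum_fintype, Fintype.sum_option]

theorem sum_choice_le_one (σ : Scheduler A) {s : S} (α : Frag A s) :
    ∑ tr : A.Tr, σ.choice α (some tr) ≤ 1 :=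
  le_add_self.trans_eq (choice_none_add_sum σ α)

theorem sum_target [Fintype S] (ρ : PMF S) : ∑ s, ρ s = 1 := by
  rw [← tsum_fintype (L := .unconditional S), ρ.tsum_coe]

/-- The probability that the execution has at least `n` steps. -/
def reach (σ : Scheduler A) (t : S) (n : ℕ) : ℝ≥0∞ := expect σ t n fun _ => 1

/-- The probability that the execution has exactly `n` steps. -/
def halt (σ : Scheduler A) (t : S) (n : ℕ) : ℝ≥0∞ := expect σ t n fun α => σ.choice α.2 none

open Classical in
/-- The probability that after `n` steps the execution is in the copy `p` of the state `w`. -/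
def occupation (σ : Scheduler A) (t : S) (a : Act) (n : ℕ) (p : Bool) (w : S) : ℝ≥0∞ :=
  expect σ t n fun α => if α.1 = w ∧ α.2.trace = phaseTrace a p then 1 else 0

open Classical in
/-- The probability that after `n` steps the execution is in the copy `p` and takes the
transition `tr`. -/
def usage (σ : Scheduler A) (t : S) (a : Act) (n : ℕ) (p : Bool) (tr : A.Tr) : ℝ≥0∞ :=
  expect σ t n fun α => if α.2.trace = phaseTrace a p then σ.choice α.2 (some tr) else 0

open Classical in
/-- The probability that the execution stops after `n` steps in the copy `p` of the state `w`. -/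
def haltAt (σ : Scheduler A) (t : S) (a : Act) (n : ℕ) (p : Bool) (w : S) : ℝ≥0∞ :=
  expect σ t n fun α => if α.1 = w ∧ α.2.trace = phaseTrace a p then σ.choice α.2 none else 0

open Classical in
/-- The probability that after `n` steps the execution is outside of all copies. -/
def stray (σ : Scheduler A) (t : S) (a : Act) (n : ℕ) : ℝ≥0∞ :=
  expect σ t n fun α => if ∃ p, α.2.trace = phaseTrace a p then 0 else 1

variable {σ : Scheduler A} {t : S} {a : Act} {n : ℕ}

theorem reach_zero : reach σ t 0 = 1 := expect_zero _

theorem stray_le_reach : stray σ t a n ≤ reach σ t n :=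
  expect_mono fun α => by split_ifs <;> simp

theorem occupation_le_reach {p : Bool} {w : S} : occupation σ t a n p w ≤ reach σ t n :=
  expect_mono fun α => by split_ifs <;> simp

theorem usage_le_reach {p : Bool} {tr : A.Tr} : usage σ t a n p tr ≤ reach σ t n :=
  expect_mono fun α => by split_ifs <;> simp [PMF.coe_le_one]

open Classical in
theorem occupation_zero {p : Bool} {w : S} :
    occupation σ t a 0 p w = if p = false ∧ w = t then 1 else 0 := by
  rw [occupation, expect_zero]
  cases p <;> simp [Frag.trace, phaseTrace, eq_comm]

theorem stray_zero : stray σ t a 0 = 0 := by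
  rw [stray, expect_zero, if_pos]
  exact ⟨false, rfl⟩

open Classical in
/-- The probability of a copy of a state splits according to what is done next. -/
theorem occupation_eq {p : Bool} {w : S} : occupation σ t a n p w =
    (∑ tr : A.Tr, if tr.1.source = w then usage σ t a n p tr else 0) + haltAt σ t a n p w := by
  have h : ∀ tr : A.Tr, (if tr.1.source = w then usage σ t a n p tr else 0) =
      expect σ t n fun α => if α.1 = w ∧ α.2.trace = phaseTrace a p then
        σ.choice α.2 (some tr) else 0 := by
    intro tr
    split_ifs with htr
    · refine expect_congr fun α => ?_
      by_cases hα : α.1 = w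
      · simp [hα]
      · have : σ.choice α.2 (some tr) = 0 := by
          by_contra hne
          exact hα ((σ.enabled α.2 tr (pos_iff_ne_zero.2 hne)).symm.trans htr)
        simp [this]
    · rw [expect, eq_comm, ENNReal.tsum_eq_zero]
      intro α
      have : α.1.1 = w → σ.choice α.1.2 (some tr) = 0 := by
        intro hα
        by_contra hne
        exact htr ((σ.enabled α.1.2 tr (pos_iff_ne_zero.2 hne)).trans hα)
      split_ifs with hc
      · rw [this hc.1, mul_zero]
      · rw [mul_zero]
  simp only [h]
  rw [← expect_sum, haltAt, ← expect_add]
  refine expect_congr fun α => ?_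
  split_ifs with hc
  · rw [add_comm, choice_none_add_sum]
  · simp

theorem exists_phaseTrace_of_append {a : Act} {l : List Act} {tr : A.Tr}
    (hl : ∀ b ∈ l, b ∉ A.hidden) (h : ∃ p, l ++ actTrace A tr.1.action = phaseTrace a p) :
    ∃ p, l = phaseTrace a p := by
  obtain ⟨p, hp⟩ := h
  obtain ⟨q, -, hq⟩ := (append_actTrace_eq_phaseTrace_iff tr hl).1 hp
  exact ⟨q, hq⟩

theorem cone_eq_zero_of_stray (h : ∀ n, stray σ t a n = 0) {s : S} (α : Frag A s)
    (hα : ¬ ∃ p, α.trace = phaseTrace a p) : σ.cone t α = 0 :=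
  cone_eq_zero_of_expect_eq_zero h α (by simp [hα])

variable [Fintype S]

theorem reach_succ_add_halt : reach σ t (n + 1) + halt σ t n = reach σ t n := by
  rw [reach, expect_succ (fun _ _ _ => 1) fun _ _ _ _ _ => rfl, halt, ← expect_add]
  refine expect_congr fun α => ?_
  simp only [mul_one, sum_target]
  rw [add_comm, choice_none_add_sum]

theorem reach_add_sum_halt (n : ℕ) : reach σ t n + ∑ k ∈ Finset.range n, halt σ t k = 1 := by
  induction n with
  | zero => simp [reach_zero]
  | succ n ih => rw [Finset.sum_range_succ, ← ih, ← reach_succ_add_halt (n := n)]; ring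

theorem reach_le_one (n : ℕ) : reach σ t n ≤ 1 :=
  le_self_add.trans_eq (reach_add_sum_halt n)

theorem tendsto_reach (h : ∑' n, halt σ t n = 1) : Tendsto (reach σ t) atTop (𝓝 0) := by
  have h1 : reach σ t = fun n => 1 - ∑ k ∈ Finset.range n, halt σ t k := by
    funext n
    refine ENNReal.eq_sub_of_add_eq ?_ (reach_add_sum_halt n)
    exact ne_top_of_le_ne_top ENNReal.one_ne_top (le_add_self.trans_eq (reach_add_sum_halt n))
  have h2 := ENNReal.tendsto_nat_tsum (halt σ t)
  rw [h] at h2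
  rw [h1]
  simpa using ENNReal.Tendsto.sub (tendsto_const_nhds (x := (1 : ℝ≥0∞))) h2 (by simp)

open Classical in
-- Flow conservation in time: whatever is in the copy `p` of `w` has just arrived from a copy. That
-- copy is unique because different copies have different traces.
theorem occupation_succ {p : Bool} {w : S} : occupation σ t a (n + 1) p w =
    ∑ q, ∑ tr : A.Tr, if Move A a tr q p then usage σ t a n q tr * tr.1.target w else 0 := by
  rw [occupation, expect_succ (fun α b r =>
    if r = w ∧ α.2.trace ++ actTrace A b = phaseTrace a p then 1 else 0)
    fun s α b r h => by simp only [Frag.trace]; congr]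
  have h : ∀ q (tr : A.Tr), (if Move A a tr q p then usage σ t a n q tr * tr.1.target w else 0) =
      expect σ t n fun α => if Move A a tr q p ∧ α.2.trace = phaseTrace a q then
        σ.choice α.2 (some tr) * tr.1.target w else 0 := by
    intro q tr
    split_ifs with hm
    · rw [usage, ← expect_mul_const]
      simp only [hm, true_and, ite_mul, zero_mul]
    · simp [hm, expect]
  simp only [h, ← expect_sum]
  refine expect_congr fun α => ?_
  rw [Finset.sum_comm]
  refine Finset.sum_congr rfl fun tr _ => ?_
  simp only [append_actTrace_eq_phaseTrace_iff tr α.2.not_hidden_of_mem_trace]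
  by_cases hq : ∃ q, Move A a tr q p ∧ α.2.trace = phaseTrace a q
  · obtain ⟨q, hq1, hq2⟩ := hq
    have hex : ∃ q, Move A a tr q p ∧ α.2.trace = phaseTrace a q := ⟨q, hq1, hq2⟩
    rw [Finset.sum_eq_single q, if_pos ⟨hq1, hq2⟩]
    · simp [hex]
    · intro q' _ hne
      rw [if_neg]
      exact fun h => hne (phaseTrace_injective a (h.2.symm.trans hq2))
    · simp
  · rw [Finset.sum_eq_zero (s := (Finset.univ : Finset Bool))]
    · simp [hq]
    · intro q _
      rw [if_neg]
      exact fun h => hq ⟨q, h⟩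

open Classical in
theorem stray_succ : stray σ t a (n + 1) = expect σ t n fun α => ∑ tr : A.Tr,
    if ∃ p, α.2.trace ++ actTrace A tr.1.action = phaseTrace a p then 0 else
      σ.choice α.2 (some tr) := by
  rw [stray, expect_succ (fun α b r =>
    if ∃ p, α.2.trace ++ actTrace A b = phaseTrace a p then 0 else 1)
    fun s α b r h => by simp [Frag.trace]]
  refine expect_congr fun α => Finset.sum_congr rfl fun tr _ => ?_
  split_ifs
  · simp
  · simp [sum_target]

/-- Such a transition leads out of both copies, so its probability of being used is part of the
stray mass one step later. -/
theorem usage_eq_zero_of_stray (h : stray σ t a (n + 1) = 0) {p : Bool} {tr : A.Tr}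
    (hm : ∀ q, ¬ Move A a tr p q) : usage σ t a n p tr = 0 := by
  classical
  refine le_antisymm ?_ zero_le
  rw [← h, stray_succ, usage]
  refine expect_mono fun α => ?_
  split_ifs with hα
  · refine le_trans ?_ (Finset.single_le_sum (fun _ _ => zero_le) (Finset.mem_univ tr))
    rw [if_neg]
    rintro ⟨q, hq⟩
    obtain ⟨p', hp', h'⟩ :=
      (append_actTrace_eq_phaseTrace_iff tr α.2.not_hidden_of_mem_trace).1 hq
    obtain rfl := phaseTrace_injective a (hα.symm.trans h')
    exact hm q hp'
  · exact zero_le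

end

/-! ### Cost on stopping versus accumulated step costs -/

noncomputable section

variable {S : Type u} {Act : Type v}

open Filter Topology

variable {A : CPA S Act}

/-- The expected cost of the transition that is scheduled after a fragment. -/
def stepCost (σ : Scheduler A.toPA) {s : S} (α : Frag A.toPA s) : ℝ≥0∞ :=
  ∑ tr : A.Tr, A.cost tr * σ.choice α (some tr)

variable {σ : Scheduler A.toPA} {t : S} {n : ℕ}

theorem normalized_le_one {s : S} (α : Frag A.toPA s) (b : Act) (r : S) (tr : A.Tr)
    (h : tr.1.action = b) : σ.normalized α r b tr ≤ 1 := by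
  classical
  unfold Scheduler.normalized
  split_ifs
  · refine ENNReal.div_le_of_le_mul ?_
    rw [one_mul, Scheduler.step]
    exact Finset.single_le_sum (f := fun tr : A.Tr => σ.choice α (some tr) * tr.1.target r)
      (fun _ _ => zero_le) (by simpa using h)
  · exact zero_le

/-- A crude bound; what matters is that it is finite and uniform over fragments of equal length, so
that it can serve as a truncation level. -/
theorem fragCost_le {s : S} (α : Frag A.toPA s) :
    fragCost σ α ≤ α.length * ∑ tr : A.Tr, (A.cost tr : ℝ≥0∞) := by
  classical
  induction α with
  | single s => simp [fragCost]
  | snoc α b r h ih =>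
    rw [fragCost, Frag.length, Nat.cast_add, Nat.cast_one, add_mul, one_mul]
    refine add_le_add ih ?_
    calc _ ≤ ∑ tr : A.Tr with tr.1.action = b, (A.cost tr : ℝ≥0∞) := by
          refine Finset.sum_le_sum fun tr htr => ?_
          exact mul_le_of_le_one_right' (normalized_le_one α b r tr (by simpa using htr))
      _ ≤ _ := Finset.sum_le_sum_of_subset (Finset.filter_subset _ _)

open Classical in
/-- Averaging the normalized cost over the transitions with the same label gives back the cost. -/
theorem sum_choice_mul_normalized {s : S} (α : Frag A.toPA s) (r : S) :
    ∑ tr : A.Tr, σ.choice α (some tr) * (tr.1.target r *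
        ∑ tr' : A.Tr with tr'.1.action = tr.1.action,
          (A.cost tr' : ℝ≥0∞) * σ.normalized α r tr.1.action tr') =
      ∑ tr : A.Tr, A.cost tr * (σ.choice α (some tr) * tr.1.target r) := by
  simp only [Finset.sum_filter, Finset.mul_sum, mul_ite, mul_zero]
  rw [Finset.sum_comm]
  refine Finset.sum_congr rfl fun tr' _ => ?_
  have h1 : ∀ tr : A.Tr, (if tr'.1.action = tr.1.action then σ.choice α (some tr) *
      (tr.1.target r * ((A.cost tr' : ℝ≥0∞) * σ.normalized α r tr.1.action tr')) else 0) =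
      (if tr.1.action = tr'.1.action then σ.choice α (some tr) * tr.1.target r else 0) *
        ((A.cost tr' : ℝ≥0∞) * σ.normalized α r tr'.1.action tr') := by
    intro tr
    by_cases h : tr'.1.action = tr.1.action
    · rw [if_pos h, if_pos h.symm, h, mul_assoc]
    · rw [if_neg h, if_neg (Ne.symm h), zero_mul]
  rw [Finset.sum_congr rfl fun tr _ => h1 tr, ← Finset.sum_mul, ← Finset.sum_filter]
  change σ.step α tr'.1.action r * _ = _
  rw [mul_left_comm]
  congr 1
  have hle : σ.choice α (some tr') * tr'.1.target r ≤ σ.step α tr'.1.action r :=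
    Finset.single_le_sum (f := fun tr : A.Tr => σ.choice α (some tr) * tr.1.target r)
      (fun _ _ => zero_le) (by simp)
  unfold Scheduler.normalized
  split_ifs with h
  · refine ENNReal.mul_div_cancel h.ne' ?_
    refine ENNReal.sum_ne_top.2 fun tr _ => ENNReal.mul_ne_top ?_ ?_ <;> exact PMF.apply_ne_top _ _
  · rw [mul_zero]
    exact (le_antisymm (hle.trans (not_lt.1 h)) zero_le).symm

theorem weakCost_eq_tsum :
    weakCost σ t = ∑' n, expect σ t n fun α => fragCost σ α.2 * σ.choice α.2 none := by
  rw [tsum_expect, weakCost]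
  exact tsum_congr fun α => mul_left_comm _ _ _

variable [Fintype S]

/-- The cost accumulated after `n + 1` steps. -/
theorem expect_fragCost_succ :
    expect σ t (n + 1) (fun α => fragCost σ α.2) +
        expect σ t n (fun α => fragCost σ α.2 * σ.choice α.2 none) =
      expect σ t n (fun α => fragCost σ α.2) + expect σ t n fun α => stepCost σ α.2 := by
  classical
  rw [expect_succ (fun α b r => fragCost σ α.2 +
    ∑ tr : A.Tr with tr.1.action = b, (A.cost tr : ℝ≥0∞) * σ.normalized α.2 r b tr)
    fun s α b r h => by rw [fragCost], ← expect_add, ← expect_add]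
  refine expect_congr fun α => ?_
  have h1 : ∑ tr : A.Tr, σ.choice α.2 (some tr) * ∑ r, tr.1.target r * fragCost σ α.2 =
      fragCost σ α.2 * ∑ tr : A.Tr, σ.choice α.2 (some tr) := by
    simp only [← Finset.sum_mul, sum_target, one_mul]
    exact mul_comm _ _
  have h2 : ∑ tr : A.Tr, σ.choice α.2 (some tr) * ∑ r, tr.1.target r *
        ∑ tr' : A.Tr with tr'.1.action = tr.1.action,
          (A.cost tr' : ℝ≥0∞) * σ.normalized α.2 r tr.1.action tr' = stepCost σ α.2 := by
    simp only [Finset.mul_sum (Finset.univ : Finset S)]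
    rw [Finset.sum_comm]
    simp only [sum_choice_mul_normalized]
    rw [Finset.sum_comm, stepCost]
    simp only [← Finset.mul_sum, sum_target, mul_one]
  simp only [mul_add, Finset.sum_add_distrib, h1, h2]
  rw [add_right_comm, ← mul_add, add_comm (∑ _, _), choice_none_add_sum, mul_one]

theorem sum_stepCost (n : ℕ) : ∑ k ∈ Finset.range n, expect σ t k (fun α => stepCost σ α.2) =
    expect σ t n (fun α => fragCost σ α.2) +
      ∑ k ∈ Finset.range n, expect σ t k fun α => fragCost σ α.2 * σ.choice α.2 none := by
  induction n with
  | zero => simp [expect_zero, fragCost]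
  | succ n ih =>
    rw [Finset.sum_range_succ, Finset.sum_range_succ, ih, add_right_comm,
      ← expect_fragCost_succ]
    ring

/-- The cost of the fragments on which the execution stops is at most the total expected cost. -/
theorem weakCost_le_tsum_stepCost :
    weakCost σ t ≤ ∑' n, expect σ t n fun α => stepCost σ α.2 := by
  rw [weakCost_eq_tsum, ENNReal.tsum_eq_iSup_nat, ENNReal.tsum_eq_iSup_nat]
  refine iSup_mono fun n => ?_
  rw [sum_stepCost]
  exact le_add_self

/-- Cost only grows along an execution, so the cost so far is either charged on stopping or still
present after the next step. The truncation keeps the part that is still running below `M` times its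
probability. -/
theorem expect_min_le (M : ℝ≥0∞) (n : ℕ) :
    expect σ t n (fun α => min (fragCost σ α.2) M) ≤
      (expect σ t n fun α => fragCost σ α.2 * σ.choice α.2 none) +
        expect σ t (n + 1) fun α => min (fragCost σ α.2) M := by
  classical
  rw [expect_succ (fun α b r => min (fragCost σ α.2 +
    ∑ tr : A.Tr with tr.1.action = b, (A.cost tr : ℝ≥0∞) * σ.normalized α.2 r b tr) M)
    fun s α b r h => by rw [fragCost], ← expect_add]
  refine expect_mono fun α => ?_
  calc min (fragCost σ α.2) M = min (fragCost σ α.2) M * σ.choice α.2 none +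
        ∑ tr : A.Tr, σ.choice α.2 (some tr) * ∑ r, tr.1.target r * min (fragCost σ α.2) M := by
        simp only [← Finset.sum_mul, sum_target, one_mul]
        rw [mul_comm (∑ _, _), ← mul_add, choice_none_add_sum, mul_one]
    _ ≤ _ := by
        gcongr
        · exact min_le_left _ _
        · exact le_self_add

/-- If the execution stops almost surely, the total expected cost is at most the cost of the
fragments on which it stops. -/
theorem sum_stepCost_le_weakCost (h : ∑' n, halt σ t n = 1) (n : ℕ) :
    ∑ k ∈ Finset.range n, expect σ t k (fun α => stepCost σ α.2) ≤ weakCost σ t := by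
  -- No fragment with `n` steps costs more than `M`, so the truncation is invisible at time `n`; at
  -- later times it makes the remainder tend to zero.
  set M : ℝ≥0∞ := n * ∑ tr : A.Tr, (A.cost tr : ℝ≥0∞) with hM
  have hMtop : M ≠ ⊤ := ENNReal.mul_ne_top (ENNReal.natCast_ne_top n)
    (ENNReal.sum_ne_top.2 fun _ _ => ENNReal.coe_ne_top)
  have hmin : expect σ t n (fun α => fragCost σ α.2) =
      expect σ t n fun α => min (fragCost σ α.2) M := by
    refine tsum_congr fun α => ?_
    have := fragCost_le (σ := σ) α.1.2
    rw [α.2] at this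
    simp only [min_eq_left this, hM]
  have hstep : ∀ j, ∑ k ∈ Finset.range n, expect σ t k (fun α => stepCost σ α.2) ≤
      (∑ k ∈ Finset.range (n + j), expect σ t k fun α => fragCost σ α.2 * σ.choice α.2 none) +
        expect σ t (n + j) fun α => min (fragCost σ α.2) M := by
    intro j
    induction j with
    | zero => rw [sum_stepCost, hmin, add_comm]; rfl
    | succ j ih =>
      refine ih.trans ?_
      rw [← add_assoc n, Finset.sum_range_succ, add_assoc]
      gcongr
      exact expect_min_le M _
  have hlim : Tendsto (fun j => weakCost σ t + reach σ t (n + j) * M) atTop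
      (𝓝 (weakCost σ t + 0 * M)) := by
    refine Tendsto.add tendsto_const_nhds (ENNReal.Tendsto.mul_const ?_ (.inr hMtop))
    exact (tendsto_reach h).comp (tendsto_add_atTop_nat n |>.congr fun j => add_comm j n)
  rw [zero_mul, add_zero] at hlim
  refine ge_of_tendsto' hlim fun j => (hstep j).trans ?_
  gcongr
  · rw [weakCost_eq_tsum]
    exact ENNReal.sum_le_tsum _
  · rw [reach, ← expect_mul_const]
    exact expect_mono fun α => by simp

end

/-! ### From schedulers to flows -/

noncomputable section

variable {S : Type u} {Act : Type v}

open Filter Topology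

section

variable {A : PA S Act} {σ : Scheduler A} {t : S} {a : Act} {μt : PMF S}

theorem coe_target (ρ : PMF S) (w : S) : ((ρ w).toNNReal : ℝ≥0∞) = ρ w :=
  ENNReal.coe_toNNReal (ρ.apply_ne_top w)

theorem coe_ite_ennreal (P : Prop) [Decidable P] (b c : ℝ≥0) :
    ((if P then b else c : ℝ≥0) : ℝ≥0∞) = if P then (b : ℝ≥0∞) else c := by
  split_ifs <;> rfl

open Classical in
theorem coe_inflow (x : Bool → A.Tr → ℝ≥0) (p : Bool) (w : S) : (inflow A a x p w : ℝ≥0∞) =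
    ∑ q, ∑ tr : A.Tr, if Move A a tr q p then (x q tr : ℝ≥0∞) * tr.1.target w else 0 := by
  simp only [inflow, ENNReal.ofNNReal_finsetSum, coe_ite_ennreal, ENNReal.coe_mul, coe_target,
    ENNReal.coe_zero]

theorem tsum_halt_eq : ∑' n, halt σ t n = ∑' α : (s : S) × Frag A s, σ.prob t α.2 :=
  tsum_expect _

theorem tsum_haltAt_eq (h : ∀ (s : S) (α : Frag A s), 0 < σ.prob t α → α.trace = actTrace A a)
    {p : Bool} {w : S} (hp : Final A a p) :
    ∑' n, haltAt σ t a n p w = ∑' α : Frag A w, σ.prob t α := by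
  classical
  simp only [haltAt]
  rw [tsum_expect, ENNReal.tsum_sigma', tsum_eq_single w]
  · refine tsum_congr fun α => ?_
    by_cases hα : α.trace = phaseTrace a p
    · simp [hα, Scheduler.prob]
    · simp only [hα, and_false, if_false, mul_zero]
      by_contra hne
      exact hα ((h w α (pos_iff_ne_zero.2 (Ne.symm hne))).trans (final_iff.1 hp))
  · intro s hs
    simp [hs]

namespace Scheduler.Induces

theorem tsum_halt (hσ : σ.Induces t a μt) : ∑' n, halt σ t n = 1 := tsum_halt_eq.trans hσ.finite

theorem cone_mul_choice_none (hσ : σ.Induces t a μt) {s : S} (α : Frag A s)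
    (h : α.trace ≠ actTrace A a) :
    σ.cone t α * σ.choice α none = 0 := by
  by_contra hne
  exact h (hσ.trace s α (pos_iff_ne_zero.2 hne))

theorem haltAt_eq_zero (hσ : σ.Induces t a μt) {n : ℕ} {p : Bool} {w : S} (hp : ¬ Final A a p) :
    haltAt σ t a n p w = 0 := by
  refine ENNReal.tsum_eq_zero.2 fun α => ?_
  beta_reduce
  split_ifs with h
  · refine hσ.cone_mul_choice_none _ fun h' => hp (final_iff.2 ?_)
    rw [← h', h.2]
  · rw [mul_zero]

theorem tsum_haltAt (hσ : σ.Induces t a μt) {p : Bool} {w : S} (hp : Final A a p) :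
    ∑' n, haltAt σ t a n p w = μt w :=
  (tsum_haltAt_eq hσ.trace hp).trans (hσ.target w)

variable [Fintype S]

/-- Stray executions neither stop, since their trace is not that of `a`, nor return to a copy. -/
theorem stray_le_succ (hσ : σ.Induces t a μt) (n : ℕ) : stray σ t a n ≤ stray σ t a (n + 1) := by
  classical
  rw [stray_succ, stray]
  refine ENNReal.tsum_le_tsum fun α => ?_
  by_cases hα : ∃ p, α.1.2.trace = phaseTrace a p
  · simp [hα]
  have hnext : ∀ tr : A.Tr, ¬ ∃ p, α.1.2.trace ++ actTrace A tr.1.action = phaseTrace a p :=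
    fun tr h => hα (exists_phaseTrace_of_append α.1.2.not_hidden_of_mem_trace h)
  simp only [hα, hnext, if_false]
  have hhalt : σ.cone t α.1.2 * σ.choice α.1.2 none = 0 := by
    obtain ⟨p, hp⟩ := exists_final A a
    exact hσ.cone_mul_choice_none _ fun h => hα ⟨p, h.trans (final_iff.1 hp)⟩
  conv_lhs => rw [← choice_none_add_sum σ α.1.2, mul_add, hhalt, zero_add]

/-- The stray mass is nondecreasing in time, yet bounded by the probability of still running, which
tends to zero. -/
theorem stray_eq_zero (hσ : σ.Induces t a μt) (n : ℕ) : stray σ t a n = 0 := by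
  refine le_antisymm ?_ zero_le
  refine ge_of_tendsto (tendsto_reach hσ.tsum_halt) ?_
  filter_upwards [eventually_ge_atTop n] with m hm
  exact (monotone_nat_of_le_succ hσ.stray_le_succ hm).trans stray_le_reach

end Scheduler.Induces

variable [Fintype S]

theorem usage_ne_top {n : ℕ} {p : Bool} {tr : A.Tr} : usage σ t a n p tr ≠ ⊤ :=
  ne_top_of_le_ne_top ENNReal.one_ne_top (usage_le_reach.trans (reach_le_one n))

variable (σ t a) in
/-- The expected number of times that a transition is taken in the first `n` steps. -/
def truncatedFlow (n : ℕ) (p : Bool) (tr : A.Tr) : ℝ≥0 :=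
  (∑ k ∈ Finset.range n, usage σ t a k p tr).toNNReal

theorem coe_truncatedFlow (n : ℕ) (p : Bool) (tr : A.Tr) :
    (truncatedFlow σ t a n p tr : ℝ≥0∞) = ∑ k ∈ Finset.range n, usage σ t a k p tr :=
  ENNReal.coe_toNNReal (ENNReal.sum_ne_top.2 fun _ _ => usage_ne_top)

open Classical in
theorem coe_outflow (x : Bool → A.Tr → ℝ≥0) (y : S → S → ℝ≥0) (p : Bool) (w : S) :
    (outflow A a x y p w : ℝ≥0∞) =
      (∑ tr : A.Tr, if tr.1.source = w then (x p tr : ℝ≥0∞) else 0) +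
        if Final A a p then ∑ u, (y u w : ℝ≥0∞) else 0 := by
  simp only [outflow, ENNReal.coe_add, ENNReal.ofNNReal_finsetSum, coe_ite_ennreal,
    ENNReal.coe_zero]

open Classical in
theorem sum_occupation_succ (n : ℕ) (p : Bool) (w : S) :
    ∑ k ∈ Finset.range (n + 1), occupation σ t a k p w = (if p = false ∧ w = t then 1 else 0) +
      ∑ q, ∑ tr : A.Tr, if Move A a tr q p then
        (∑ k ∈ Finset.range n, usage σ t a k q tr) * tr.1.target w else 0 := by
  rw [Finset.sum_range_succ', occupation_zero, add_comm]
  congr 1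
  simp only [occupation_succ]
  rw [Finset.sum_comm]
  refine Finset.sum_congr rfl fun q _ => ?_
  rw [Finset.sum_comm]
  refine Finset.sum_congr rfl fun tr _ => ?_
  split_ifs
  · rw [Finset.sum_mul]
  · simp

open Classical in
/-- Balance of the truncated flow at a copy of a state. -/
theorem truncatedFlow_balance (n : ℕ) (p : Bool) (w : S) :
    (if p = false ∧ w = t then 1 else 0) + (inflow A a (truncatedFlow σ t a n) p w : ℝ≥0∞) =
      (∑ tr : A.Tr, if tr.1.source = w then (truncatedFlow σ t a n p tr : ℝ≥0∞) else 0) +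
        ∑ k ∈ Finset.range n, haltAt σ t a k p w + occupation σ t a n p w := by
  rw [coe_inflow]
  simp only [coe_truncatedFlow]
  rw [← sum_occupation_succ, Finset.sum_range_succ]
  congr 1
  simp only [occupation_eq, Finset.sum_add_distrib]
  congr 1
  rw [Finset.sum_comm]
  refine Finset.sum_congr rfl fun tr _ => ?_
  split_ifs <;> simp

/-- A scheduler that induces a suitable weak transition yields a solution of the reduced linear
program whose cost is at most the expected cost of the scheduler. -/
theorem Scheduler.Induces.exists_isFlow {μ : PMF S} {R : S → S → Prop} (hσ : σ.Induces t a μt)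
    (hR : Lift R μ μt) (c : A.Tr → ℝ≥0) (K : ℝ≥0)
    (hK : ∀ n, ∑ k ∈ Finset.range n, expect σ t k (fun α => ∑ tr : A.Tr,
      (c tr : ℝ≥0∞) * σ.choice α.2 (some tr)) ≤ K) :
    ∃ x y, IsFlow A t a μ R x y ∧ ∑ p, ∑ tr : A.Tr, c tr * x p tr ≤ K := by
  classical
  obtain ⟨w, hw1, hwR, hwμ, hwt⟩ := hR
  have hwtop : ∀ u s, w u s ≠ ⊤ := fun u s => ne_top_of_le_ne_top ENNReal.one_ne_top (hw1 u s)
  set y : S → S → ℝ≥0 := fun u s => (w u s).toNNReal with hy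
  have hyw : ∀ u s, (y u s : ℝ≥0∞) = w u s := fun u s => ENNReal.coe_toNNReal (hwtop u s)
  refine exists_isFlow_of_tendsto (x := truncatedFlow σ t a) (y := y) ?_ ?_ ?_ ?_ c K ?_
  · intro n p tr hm
    rw [← ENNReal.coe_inj, coe_truncatedFlow]
    exact Finset.sum_eq_zero fun k _ => usage_eq_zero_of_stray (hσ.stray_eq_zero _) hm
  · intro u s hus
    rw [← ENNReal.coe_inj, hyw, ENNReal.coe_zero]
    by_contra h
    exact hus (hwR u s (pos_iff_ne_zero.2 h))
  · intro p s
    have hfin : (if Final A a p then ∑ u, (y u s : ℝ≥0∞) else 0) =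
        ∑' n, haltAt σ t a n p s := by
      split_ifs with hp
      · simp only [hyw, hwt, hσ.tsum_haltAt hp]
      · simp [hσ.haltAt_eq_zero hp]
    have htop : ∑' n, haltAt σ t a n p s ≠ ⊤ := by
      rw [← hfin]
      split_ifs
      · exact ENNReal.sum_ne_top.2 fun _ _ => ENNReal.coe_ne_top
      · simp
    have hocctop : ∀ n, occupation σ t a n p s ≠ ⊤ := fun n =>
      ne_top_of_le_ne_top ENNReal.one_ne_top (occupation_le_reach.trans (reach_le_one n))
    have hpart : ∀ n, ∑ k ∈ Finset.range n, haltAt σ t a k p s ≠ ⊤ := fun n =>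
      ne_top_of_le_ne_top htop (ENNReal.sum_le_tsum _)
    -- The defect is the source term plus the tail of the stopping probabilities at `s`, minus the
    -- mass still sitting at `s` after `n` steps.
    have hbal : ∀ n, (outflow A a (truncatedFlow σ t a n) y p s : ℝ) -
        inflow A a (truncatedFlow σ t a n) p s = (if p = false ∧ s = t then 1 else 0) +
          (∑' n, haltAt σ t a n p s).toReal -
          (∑ k ∈ Finset.range n, haltAt σ t a k p s).toReal - (occupation σ t a n p s).toReal := by
      intro n
      have h1 : (if p = false ∧ s = t then 1 else 0) +
          (inflow A a (truncatedFlow σ t a n) p s : ℝ≥0∞) + ∑' n, haltAt σ t a n p s =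
          (outflow A a (truncatedFlow σ t a n) y p s : ℝ≥0∞) +
            ∑ k ∈ Finset.range n, haltAt σ t a k p s + occupation σ t a n p s := by
        rw [truncatedFlow_balance, coe_outflow, hfin]
        ring
      have h2 := congrArg ENNReal.toReal h1
      have hite : (if p = false ∧ s = t then (1 : ℝ≥0∞) else 0) ≠ ⊤ := by split_ifs <;> simp
      rw [ENNReal.toReal_add (by finiteness) htop, ENNReal.toReal_add hite (by finiteness),
        ENNReal.toReal_add (ENNReal.add_ne_top.2 ⟨by finiteness, hpart n⟩) (hocctop n),
        ENNReal.toReal_add (by finiteness) (hpart n), ENNReal.coe_toReal, ENNReal.coe_toReal] at h2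
      have h3 : (if p = false ∧ s = t then (1 : ℝ≥0∞) else 0).toReal =
          if p = false ∧ s = t then 1 else 0 := by split_ifs <;> simp
      rw [h3] at h2
      linarith
    simp only [hbal]
    have hlim1 : Tendsto (fun n => (∑ k ∈ Finset.range n, haltAt σ t a k p s).toReal) atTop
        (𝓝 (∑' n, haltAt σ t a n p s).toReal) :=
      (ENNReal.tendsto_toReal htop).comp (ENNReal.tendsto_nat_tsum _)
    have hlim2 : Tendsto (fun n => (occupation σ t a n p s).toReal) atTop (𝓝 0) := by
      have : Tendsto (fun n => occupation σ t a n p s) atTop (𝓝 0) :=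
        tendsto_of_tendsto_of_tendsto_of_le_of_le tendsto_const_nhds
          (tendsto_reach hσ.tsum_halt) (fun _ => zero_le) fun _ => occupation_le_reach
      exact (ENNReal.tendsto_toReal ENNReal.zero_ne_top).comp this
    have hlim := ((tendsto_const_nhds (x := (if p = false ∧ s = t then (1 : ℝ) else 0) +
      (∑' n, haltAt σ t a n p s).toReal)).sub hlim1).sub hlim2
    rwa [add_sub_cancel_right, sub_zero] at hlim
  · intro u
    rw [← ENNReal.coe_inj, ENNReal.ofNNReal_finsetSum, coe_target, ← hwμ]
    simp only [hyw]
  · intro n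
    rw [← ENNReal.coe_le_coe]
    refine le_trans ?_ (hK n)
    simp only [ENNReal.ofNNReal_finsetSum, ENNReal.coe_mul, coe_truncatedFlow]
    calc ∑ p, ∑ tr : A.Tr, (c tr : ℝ≥0∞) * ∑ k ∈ Finset.range n, usage σ t a k p tr
        = ∑ k ∈ Finset.range n, ∑ p, ∑ tr : A.Tr, usage σ t a k p tr * c tr := by
          rw [Finset.sum_comm (s := Finset.range n)]
          refine Finset.sum_congr rfl fun p _ => ?_
          rw [Finset.sum_comm]
          refine Finset.sum_congr rfl fun tr _ => ?_
          rw [mul_comm, Finset.sum_mul]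
      -- A fragment belongs to at most one copy, so no choice is counted twice; those outside both
      -- copies only help the inequality.
      _ ≤ _ := by
          refine Finset.sum_le_sum fun k _ => ?_
          simp only [usage, ← expect_mul_const, ← expect_sum]
          refine expect_mono fun α => ?_
          rw [Finset.sum_comm]
          refine Finset.sum_le_sum fun tr _ => ?_
          rw [← Finset.sum_mul, mul_comm]
          gcongr
          by_cases hα : ∃ p, α.2.trace = phaseTrace a p
          · obtain ⟨p, hp⟩ := hα
            simp [hp, (phaseTrace_injective a).eq_iff]
          · push Not at hα
            simp [hα]

end

variable [Fintype S] {A : CPA S Act} {σ : Scheduler A.toPA} {t : S} {a : Act} {μ μt : PMF S}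
  {R : S → S → Prop}

/-- Every scheduler that induces a suitable weak transition costs at least the optimal value of
the linear program, which is attained. -/
theorem exists_optimal_le_weakCost (hσ : σ.Induces t a μt) (hR : Lift R μ μt) :
    ∃ f, Optimal A t a μ R f ∧ ENNReal.ofReal (objective A t a R f) ≤ weakCost σ t := by
  -- Feasibility is obtained with the zero cost, because `weakCost` may be infinite and then bounds
  -- nothing.
  obtain ⟨x, y, hxy, -⟩ := hσ.exists_isFlow hR 0 0 (by simp [expect])
  obtain ⟨x₀, y₀, h₀, hmin⟩ := hxy.exists_optimal A.cost
  refine ⟨arcFlow A.toPA t a μ x₀ y₀, ⟨h₀.feasible, fun g hg => ?_⟩, ?_⟩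
  · obtain ⟨x', y', h', rfl⟩ := hg.exists_isFlow
    rw [objective_arcFlow h₀, objective_arcFlow h']
    exact NNReal.coe_le_coe.2 (hmin x' y' h')
  · rw [objective_arcFlow h₀, ENNReal.ofReal_coe_nnreal]
    by_cases htop : weakCost σ t = ⊤
    · rw [htop]; exact le_top
    lift weakCost σ t to ℝ≥0 using htop with K hK
    obtain ⟨x', y', h', hK'⟩ := hσ.exists_isFlow hR A.cost K fun n => by
      rw [hK]; exact sum_stepCost_le_weakCost hσ.tsum_halt n
    exact ENNReal.coe_le_coe.2 ((hmin x' y' h').trans hK')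

end

/-! ### From flows to determinate schedulers -/

noncomputable section

variable {S : Type u} {Act : Type v}

open Filter Topology

section

variable [Fintype S] {A : PA S Act}

open Classical in
/-- The choice made in the copy `p` of the state `s`: proportional to the outgoing flow. -/
def nodeChoice (a : Act) (x : Bool → A.Tr → ℝ≥0) (y : S → S → ℝ≥0) (p : Bool) (s : S) :
    PMF (Option A.Tr) :=
  -- Without outgoing flow the proportions are undefined. Stopping is always legal, and such nodes
  -- turn out to be visited with probability zero.
  if h : outflow A a x y p s = 0 then PMF.pure none else
    PMF.ofFintype (fun o => (match o with
      | none => if Final A a p then ∑ u, (y u s : ℝ≥0∞) else 0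
      | some tr => if tr.1.source = s then (x p tr : ℝ≥0∞) else 0) / outflow A a x y p s) (by
        rw [Fintype.sum_option]
        simp only [div_eq_mul_inv]
        rw [← Finset.sum_mul, ← add_mul, add_comm, ← coe_outflow, ← div_eq_mul_inv]
        exact ENNReal.div_self (by simpa using h) ENNReal.coe_ne_top)

variable {t : S} {a : Act} {μ : PMF S} {R : S → S → Prop}
  {x : Bool → A.Tr → ℝ≥0} {y : S → S → ℝ≥0} {p : Bool} {s : S}

open Classical in
-- The product form also covers nodes without flow: there each single `x p tr` on an outgoing
-- transition is zero as well.
theorem mul_nodeChoice_some (tr : A.Tr) : (outflow A a x y p s : ℝ≥0∞) *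
    nodeChoice a x y p s (some tr) = if tr.1.source = s then (x p tr : ℝ≥0∞) else 0 := by
  by_cases h : outflow A a x y p s = 0
  · rw [h, ENNReal.coe_zero, zero_mul, eq_comm, ← nonpos_iff_eq_zero]
    have hle : _ ≤ (outflow A a x y p s : ℝ≥0∞) := le_self_add.trans_eq (coe_outflow x y p s).symm
    rw [h, ENNReal.coe_zero] at hle
    refine le_trans ?_ hle
    exact Finset.single_le_sum
      (f := fun tr : A.Tr => if tr.1.source = s then (x p tr : ℝ≥0∞) else 0) (fun _ _ => zero_le) (Finset.mem_univ tr)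
  · rw [nodeChoice, dif_neg h, PMF.ofFintype_apply]
    exact ENNReal.mul_div_cancel (by simpa using h) ENNReal.coe_ne_top

open Classical in
theorem mul_nodeChoice_none_le : (outflow A a x y p s : ℝ≥0∞) *
    nodeChoice a x y p s none ≤ if Final A a p then ∑ u, (y u s : ℝ≥0∞) else 0 := by
  by_cases h : outflow A a x y p s = 0
  · rw [h, ENNReal.coe_zero, zero_mul]
    exact zero_le
  · rw [nodeChoice, dif_neg h, PMF.ofFintype_apply]
    exact (ENNReal.mul_div_cancel (by simpa using h) ENNReal.coe_ne_top).le

theorem nodeChoice_some_eq_zero {tr : A.Tr} (h : tr.1.source ≠ s ∨ x p tr = 0) :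
    nodeChoice a x y p s (some tr) = 0 := by
  classical
  by_cases h0 : outflow A a x y p s = 0
  · rw [nodeChoice, dif_pos h0]
    simp
  · have := mul_nodeChoice_some (a := a) (x := x) (y := y) (p := p) (s := s) tr
    have h1 : (if tr.1.source = s then (x p tr : ℝ≥0∞) else 0) = 0 := by
      rcases h with h | h <;> simp [h]
    rw [h1] at this
    simpa [h0] using this

open Classical in
/-- The choice made after a fragment with trace `l` that ends in `s`. -/
def flowChoice (a : Act) (x : Bool → A.Tr → ℝ≥0) (y : S → S → ℝ≥0) (l : List Act) (s : S) :
    PMF (Option A.Tr) :=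
  if l = phaseTrace a false then nodeChoice a x y false s
  else if l = phaseTrace a true then nodeChoice a x y true s
  else PMF.pure none

/-- The determinate scheduler that follows a solution of the reduced linear program. -/
def flowScheduler (a : Act) (x : Bool → A.Tr → ℝ≥0) (y : S → S → ℝ≥0) : Scheduler A where
  choice {s} α := flowChoice a x y α.trace s
  enabled {s} α tr h := by
    by_contra hne
    refine h.ne' ?_
    unfold flowChoice
    split_ifs
    · exact nodeChoice_some_eq_zero (.inl hne)
    · exact nodeChoice_some_eq_zero (.inl hne)
    · simp

theorem flowScheduler_determinate : (flowScheduler a x y).Determinate := by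
  intro s α α' h
  simp only [flowScheduler, h]

theorem flowScheduler_choice {α : Frag A s} (h : α.trace = phaseTrace a p) :
    (flowScheduler a x y).choice α = nodeChoice a x y p s := by
  cases p <;> simp [flowScheduler, flowChoice, h, (phaseTrace_injective a).eq_iff]

/-- Markov property: in a copy, the choice depends on the past only through the copy and the current
state. -/
theorem usage_flowScheduler (n : ℕ) (tr : A.Tr) : usage (flowScheduler a x y) t a n p tr =
    occupation (flowScheduler a x y) t a n p tr.1.source *
      nodeChoice a x y p tr.1.source (some tr) := by
  rw [usage, occupation, ← expect_mul_const]
  refine expect_congr fun ⟨s, α⟩ => ?_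
  by_cases h : α.trace = phaseTrace a p
  · by_cases hs : s = tr.1.source
    · subst hs
      simp [h, flowScheduler_choice h]
    · simp [h, hs, flowScheduler_choice h, nodeChoice_some_eq_zero (.inl (Ne.symm hs))]
  · simp [h]

theorem haltAt_flowScheduler (n : ℕ) : haltAt (flowScheduler a x y) t a n p s =
    occupation (flowScheduler a x y) t a n p s * nodeChoice a x y p s none := by
  rw [haltAt, occupation, ← expect_mul_const]
  refine expect_congr fun ⟨s', α⟩ => ?_
  by_cases h : α.trace = phaseTrace a p
  · by_cases hs : s' = s
    · subst hs
      simp [h, flowScheduler_choice h]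
    · simp [hs]
  · simp [h]

theorem reach_le (σ : Scheduler A) (n : ℕ) :
    reach σ t n ≤ stray σ t a n + ∑ p, ∑ s, occupation σ t a n p s := by
  classical
  simp only [reach, stray, occupation, ← expect_sum, ← expect_add]
  refine expect_mono fun α => ?_
  by_cases h : ∃ p, α.2.trace = phaseTrace a p
  · obtain ⟨p, hp⟩ := h
    refine le_trans ?_ le_add_self
    refine le_trans ?_ (Finset.single_le_sum (fun _ _ => zero_le) (Finset.mem_univ p))
    refine le_trans ?_ (Finset.single_le_sum (fun _ _ => zero_le) (Finset.mem_univ α.1))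
    simp [hp]
  · simp [h]

theorem halt_le (σ : Scheduler A) (n : ℕ) :
    halt σ t n ≤ stray σ t a n + ∑ p, ∑ s, haltAt σ t a n p s := by
  classical
  simp only [halt, stray, haltAt, ← expect_sum, ← expect_add]
  refine expect_mono fun α => ?_
  by_cases h : ∃ p, α.2.trace = phaseTrace a p
  · obtain ⟨p, hp⟩ := h
    refine le_trans ?_ le_add_self
    refine le_trans ?_ (Finset.single_le_sum (fun _ _ => zero_le) (Finset.mem_univ p))
    refine le_trans ?_ (Finset.single_le_sum (fun _ _ => zero_le) (Finset.mem_univ α.1))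
    simp [hp]
  · simp only [h, if_false]
    exact (PMF.coe_le_one _ _).trans le_self_add

namespace IsFlow

/-- The scheduler uses only transitions with positive flow, and by the support condition these stay
inside the copies. -/
theorem stray_eq_zero (h : IsFlow A t a μ R x y) (n : ℕ) :
    stray (flowScheduler a x y) t a n = 0 := by
  classical
  induction n with
  | zero => exact stray_zero
  | succ n ih =>
    rw [← nonpos_iff_eq_zero, ← ih, stray_succ, stray]
    refine expect_mono fun ⟨s, α⟩ => ?_
    by_cases hα : ∃ q, α.trace = phaseTrace a q
    · obtain ⟨q, hq⟩ := hα
      rw [if_pos ⟨q, hq⟩, nonpos_iff_eq_zero]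
      refine Finset.sum_eq_zero fun tr _ => ?_
      split_ifs with hgood
      · rfl
      rw [flowScheduler_choice hq]
      refine nodeChoice_some_eq_zero (.inr (h.support_x q tr fun p hp => hgood ⟨p, ?_⟩))
      rw [append_actTrace_eq_phaseTrace_iff tr α.not_hidden_of_mem_trace]
      exact ⟨q, hp, hq⟩
    · simp only [hα, if_false]
      refine le_trans (Finset.sum_le_sum fun tr _ => ?_)
        (sum_choice_le_one (flowScheduler a x y) α)
      split_ifs <;> simp

theorem sum_usage_le_of_sum_occupation_le {n : ℕ}
    (h : ∀ p s, ∑ k ∈ Finset.range n, occupation (flowScheduler a x y) t a k p s ≤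
      outflow A a x y p s) (p : Bool) (tr : A.Tr) :
    ∑ k ∈ Finset.range n, usage (flowScheduler a x y) t a k p tr ≤ x p tr := by
  classical
  simp only [usage_flowScheduler, ← Finset.sum_mul]
  refine (mul_le_mul_left (h p tr.1.source) _).trans ?_
  rw [mul_nodeChoice_some, if_pos rfl]

/-- If visits before time `n` are bounded by the outflow, uses are bounded by `x`. Then visits up to
time `n` are bounded by source plus inflow, which is the outflow by balance. Equality can fail where
the flow circulates out of reach of `t`. -/
theorem sum_occupation_le (h : IsFlow A t a μ R x y) (n : ℕ) (p : Bool) (s : S) :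
    ∑ k ∈ Finset.range n, occupation (flowScheduler a x y) t a k p s ≤ outflow A a x y p s := by
  classical
  induction n generalizing p s with
  | zero => simp
  | succ n ih =>
    rw [sum_occupation_succ, ← h.balance, ENNReal.coe_add, coe_inflow, coe_ite_ennreal]
    gcongr with q _ tr _
    · simp
    · split_ifs
      · gcongr
        exact sum_usage_le_of_sum_occupation_le ih q tr
      · rfl

theorem tsum_occupation_le (h : IsFlow A t a μ R x y) (p : Bool) (s : S) :
    ∑' n, occupation (flowScheduler a x y) t a n p s ≤ outflow A a x y p s :=
  ENNReal.tsum_le_of_sum_range_le fun n => h.sum_occupation_le n p s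

theorem tsum_usage_le (h : IsFlow A t a μ R x y) (p : Bool) (tr : A.Tr) :
    ∑' n, usage (flowScheduler a x y) t a n p tr ≤ x p tr :=
  ENNReal.tsum_le_of_sum_range_le fun n =>
    sum_usage_le_of_sum_occupation_le (h.sum_occupation_le n) p tr

open Classical in
theorem tsum_haltAt_le (h : IsFlow A t a μ R x y) (p : Bool) (s : S) :
    ∑' n, haltAt (flowScheduler a x y) t a n p s ≤
      if Final A a p then ∑ u, (y u s : ℝ≥0∞) else 0 := by
  simp only [haltAt_flowScheduler, ENNReal.tsum_mul_right]
  exact (mul_le_mul_left (h.tsum_occupation_le p s) _).trans mul_nodeChoice_none_le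

/-- The expected numbers of visits are finite and there are finitely many nodes, so the
probabilities of still running are summable and tend to zero. -/
theorem tsum_halt (h : IsFlow A t a μ R x y) : ∑' n, halt (flowScheduler a x y) t n = 1 := by
  have hsum : ∑' n, reach (flowScheduler a x y) t n ≠ ⊤ := by
    refine ne_top_of_le_ne_top ?_ (ENNReal.tsum_le_tsum fun n =>
      reach_le (t := t) (a := a) (flowScheduler a x y) n)
    simp only [h.stray_eq_zero, zero_add]
    rw [Summable.tsum_finsetSum fun _ _ => ENNReal.summable]
    refine ENNReal.sum_ne_top.2 fun p _ => ?_
    rw [Summable.tsum_finsetSum fun _ _ => ENNReal.summable]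
    exact ENNReal.sum_ne_top.2 fun s _ =>
      ne_top_of_le_ne_top ENNReal.coe_ne_top (h.tsum_occupation_le p s)
  have hlim := (ENNReal.tendsto_atTop_zero_of_tsum_ne_top hsum).add
    (ENNReal.tendsto_nat_tsum (halt (flowScheduler a x y) t))
  simp only [reach_add_sum_halt, zero_add] at hlim
  exact tendsto_nhds_unique hlim tendsto_const_nhds

/-- The distribution of the final states that belongs to a solution of the reduced program. -/
def target (h : IsFlow A t a μ R x y) : PMF S :=
  PMF.ofFintype (fun s => ∑ u, (y u s : ℝ≥0∞)) (by
    rw [Finset.sum_comm, ← sum_target μ]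
    refine Finset.sum_congr rfl fun u _ => ?_
    rw [← ENNReal.ofNNReal_finsetSum, h.rel, coe_target])

theorem lift_target (h : IsFlow A t a μ R x y) : Lift R μ h.target := by
  have hrel : ∀ u, ∑ s, (y u s : ℝ≥0∞) = μ u := fun u => by
    rw [← ENNReal.ofNNReal_finsetSum, h.rel, coe_target]
  refine ⟨fun u s => y u s, fun u s => ?_, fun u s hus => ?_, hrel, fun s => ?_⟩
  · refine le_trans ?_ (μ.coe_le_one u)
    rw [← hrel u]
    exact Finset.single_le_sum (f := fun s => (y u s : ℝ≥0∞)) (fun _ _ => zero_le)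
      (Finset.mem_univ s)
  · by_contra hR
    simp [h.support_y u s hR] at hus
  · rw [target, PMF.ofFintype_apply]

/-- The stopping probabilities are bounded pointwise by the target. Both have total mass one, since
the execution stops almost surely and only in the final copy, so all the bounds are equalities. -/
theorem tsum_haltAt (h : IsFlow A t a μ R x y) (hp : Final A a p) (s : S) :
    ∑' n, haltAt (flowScheduler a x y) t a n p s = h.target s := by
  classical
  have hle : ∀ s, ∑' n, haltAt (flowScheduler a x y) t a n p s ≤ h.target s := fun s => by
    have := h.tsum_haltAt_le p s
    rwa [if_pos hp] at this
  have hother : ∀ q s n, q ≠ p → haltAt (flowScheduler a x y) t a n q s = 0 := by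
    intro q s n hq
    have hnf : ¬ Final A a q := fun hf =>
      hq (phaseTrace_injective a ((final_iff.1 hf).symm.trans (final_iff.1 hp)))
    have := h.tsum_haltAt_le q s
    rw [if_neg hnf, nonpos_iff_eq_zero] at this
    exact ENNReal.tsum_eq_zero.1 this n
  have hsum : ∑ s, h.target s ≤ ∑ s, ∑' n, haltAt (flowScheduler a x y) t a n p s := by
    rw [sum_target, ← h.tsum_halt, ← Summable.tsum_finsetSum fun _ _ => ENNReal.summable]
    refine ENNReal.tsum_le_tsum fun n => (halt_le (a := a) _ n).trans ?_
    rw [h.stray_eq_zero, zero_add, Finset.sum_eq_single p]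
    · intro q _ hq
      exact Finset.sum_eq_zero fun s _ => hother q s n hq
    · simp
  refine le_antisymm (hle s) ?_
  have hrest : ∑ r ∈ Finset.univ.erase s, h.target r ≠ ⊤ :=
    ENNReal.sum_ne_top.2 fun r _ => h.target.apply_ne_top r
  rw [← ENNReal.add_le_add_iff_right hrest, Finset.add_sum_erase _ _ (Finset.mem_univ s)]
  refine hsum.trans ?_
  rw [← Finset.add_sum_erase _ _ (Finset.mem_univ s)]
  gcongr with r _
  exact hle r

theorem induces (h : IsFlow A t a μ R x y) : (flowScheduler a x y).Induces t a h.target := by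
  classical
  have htrace : ∀ (s : S) (α : Frag A s), 0 < (flowScheduler a x y).prob t α →
      α.trace = actTrace A a := by
    intro s α hα
    by_contra hne
    refine hα.ne' ?_
    by_cases hg : ∃ p, α.trace = phaseTrace a p
    · obtain ⟨p, hp⟩ := hg
      have hle := h.tsum_haltAt_le p s
      rw [if_neg (fun hf => hne (hp.trans (final_iff.1 hf).symm)), nonpos_iff_eq_zero] at hle
      have := ENNReal.tsum_eq_zero.1 (ENNReal.tsum_eq_zero.1 hle α.length) ⟨⟨s, α⟩, rfl⟩
      simpa [hp, Scheduler.prob] using this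
    · rw [Scheduler.prob, cone_eq_zero_of_stray h.stray_eq_zero α hg, zero_mul]
  obtain ⟨p, hp⟩ := exists_final A a
  exact ⟨tsum_halt_eq.symm.trans h.tsum_halt, htrace, fun s =>
    (tsum_haltAt_eq htrace hp).symm.trans (h.tsum_haltAt hp s)⟩

end IsFlow

end

variable {A : CPA S Act} {t : S} {a : Act}

theorem expect_stepCost_le (σ : Scheduler A.toPA) (n : ℕ) :
    expect σ t n (fun α => stepCost σ α.2) ≤ stray σ t a n * (∑ tr : A.Tr, (A.cost tr : ℝ≥0∞)) +
      ∑ p, ∑ tr : A.Tr, usage σ t a n p tr * A.cost tr := by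
  classical
  simp only [stray, usage, ← expect_mul_const, ← expect_sum, ← expect_add]
  refine expect_mono fun α => ?_
  by_cases h : ∃ p, α.2.trace = phaseTrace a p
  · obtain ⟨p, hp⟩ := h
    refine le_trans ?_ le_add_self
    refine le_trans ?_ (Finset.single_le_sum (fun _ _ => zero_le) (Finset.mem_univ p))
    simp only [hp, if_true]
    exact Finset.sum_le_sum fun tr _ => (mul_comm _ _).le
  · refine le_trans ?_ le_self_add
    simp only [h, if_false, one_mul]
    exact Finset.sum_le_sum fun tr _ => mul_le_of_le_one_right' (PMF.coe_le_one _ _)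

variable [Fintype S] {μ : PMF S} {R : S → S → Prop}
  {x : Bool → A.Tr → ℝ≥0} {y : S → S → ℝ≥0}

theorem IsFlow.weakCost_le (h : IsFlow A.toPA t a μ R x y) :
    weakCost (flowScheduler a x y) t ≤ flowCost A x := by
  refine weakCost_le_tsum_stepCost.trans ?_
  refine (ENNReal.tsum_le_tsum fun n => expect_stepCost_le (a := a) _ n).trans ?_
  simp only [h.stray_eq_zero, zero_mul, zero_add, flowCost, ENNReal.ofNNReal_finsetSum,
    ENNReal.coe_mul]
  rw [Summable.tsum_finsetSum fun _ _ => ENNReal.summable]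
  refine Finset.sum_le_sum fun p _ => ?_
  rw [Summable.tsum_finsetSum fun _ _ => ENNReal.summable]
  refine Finset.sum_le_sum fun tr _ => ?_
  rw [ENNReal.tsum_mul_right, mul_comm]
  gcongr
  exact h.tsum_usage_le p tr

/-- Every optimal solution of the linear program yields a determinate scheduler of the same cost. -/
theorem Optimal.exists_scheduler {f : Vertex A.toPA → Vertex A.toPA → ℝ}
    (hf : Optimal A t a μ R f) : ∃ (σ : Scheduler A.toPA) (μt : PMF S),
      σ.Determinate ∧ σ.Induces t a μt ∧ Lift R μ μt ∧
        weakCost σ t = ENNReal.ofReal (objective A t a R f) := by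
  obtain ⟨x, y, h, rfl⟩ := hf.1.exists_isFlow
  refine ⟨flowScheduler a x y, h.target, flowScheduler_determinate, h.induces, h.lift_target,
    le_antisymm ?_ ?_⟩
  · rw [objective_arcFlow h, ENNReal.ofReal_coe_nnreal]
    exact h.weakCost_le
  -- The scheduler might be cheaper than the flow it came from. But its cost dominates the value of
  -- some optimal, hence feasible, solution `g`, and `f` costs no more than `g`.
  · obtain ⟨g, hg, hle⟩ := exists_optimal_le_weakCost h.induces h.lift_target
    exact (ENNReal.ofReal_le_ofReal (hf.2 g hg.1)).trans hle

end

end CostPA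

theorem mainTheorem5 {S : Type u} [Fintype S] {Act : Type v} (A : CostPA.CPA S Act)
    (R : S → S → Prop) (a : Act) (μ : PMF S) (t : S) :
    (∀ (σ : CostPA.Scheduler A.toPA) (μt : PMF S), σ.Induces t a μt → CostPA.Lift R μ μt →
      ∃ f, CostPA.Optimal A t a μ R f ∧
        ENNReal.ofReal (CostPA.objective A t a R f) ≤ CostPA.weakCost σ t) ∧
    (∀ f, CostPA.Optimal A t a μ R f →
      ∃ (σ : CostPA.Scheduler A.toPA) (μt : PMF S), σ.Determinate ∧ σ.Induces t a μt ∧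
        CostPA.Lift R μ μt ∧
        CostPA.weakCost σ t = ENNReal.ofReal (CostPA.objective A t a R f)) :=
  ⟨fun _ _ hσ hR => CostPA.exists_optimal_le_weakCost hσ hR, fun _ hf => hf.exists_scheduler⟩
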